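/- **Setting.** A trial has $n\ge 1$ independent clusters, $J\ge 2$ periods and $m\ge 1$ individuals per cluster-period. Individual $k$ of cluster $i$ in period $j$ has event time $T_{ijk}$, censoring time $C_{ijk}$ and treatment indicator $Z_{ij}\in\{0,1\}$, and is followed on $(0,C^*]$. Treatment sequences $(Z_{i1},\dots,Z_{iJ})$ have an arbitrary known law, the same for all clusters. Within a cluster, the censoring times are independent of the event times and the treatments jointly (i.e. conditionally independent of the event times given treatment, with a law that does not depend on treatment). They have survival functions $\mathscr G(s)=P(C_{ijk}\ge s)$ (which may depend on $j$) and, for two distinct individuals, $\mathscr G(s,t)=P(C_{ijk}\ge s,C_{ild}\ge t)$ (which may depend on $(j,l)$). Let $\lambda_{0j}\ge 0$ be integrable on $(0,C^*]$. Under $H_c:\beta=\beta_c$, $c\in\{0,1\}$, the data follow the period-stratified marginal Cox model: given $Z_{ij}=a$, $T_{ijk}$ has hazard $\lambda^{c}_{j}(t|a)=\lambda_{0j}(t)e^{\beta_c a}$ on $(0,C^*]$, with survival function $\mathscr F_j(s|a)$ and density $f_j(s|a)$. Given $Z_{ij}=a,Z_{il}=b$, the event times $(T_{ijk},T_{ild})$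 of two distinct individuals of a cluster have joint density $f(s,t|a,b)$ and joint survival function $\mathscr F(s,t|a,b)$, which depend only on the periods $j,l$ and on $a,b$. **Null score.** Let $N_{ijk}(t)=\mathbb I(T_{ijk}\le t)$, $\overline Y_{ijk}(t)=\mathbb I(T_{ijk}\ge t,C_{ijk}\ge t)$, $s_j^{(r)}(t;\beta_0)=E_{H_c}\{\sum_k\overline Y_{ijk}(t)Z_{ij}^re^{\beta_0Z_{ij}}\}$, $\mu_j=s^{(1)}_j/s^{(0)}_j$, and $$U_{ijk}(\beta_0)=\int_0^{C^*}\overline Y_{ijk}(t)\{Z_{ij}-\mu_j(t)\}\,\{dN_{ijk}(t)-\overline Y_{ijk}(t)\lambda_{0j}(t)e^{\beta_0Z_{ij}}dt\},\qquad U(\beta_0)=\sum_{i=1}^n\sum_{j=1}^J\sum_{k=1}^mU_{ijk}(\beta_0).$$ Thus the data ($N$, $\overline Y$) are generated under $\beta_c$, and the model hazard and weights are evaluated at $\beta_0$. **Components.** Write $\lambda^0_j(t|a)=\lambda_{0j}(t)e^{\beta_0a}$, $g_j(s|a)=f_j(s|a)-\mathscr F_j(s|a)\lambda^0_j(s|a)$,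 $w(s,t)=\mathscr G(s,t)\{a-\mu_j(s)\}\{b-\mu_l(t)\}$, all single integrals being over $(0,C^*]$ and all double integrals over $(0,C^*]^2$, and put $$q_0(a)=\int\mathscr G(s)\{a-\mu_j(s)\}^2f_j(s|a)\,ds,\qquad r_0(a)=-2\int\mathscr G(s)\{a-\mu_j(s)\}\Big[\int_0^s\{a-\mu_j(u)\}\lambda^0_j(u|a)du\Big]g_j(s|a)\,ds,$$ $$e_j=\sum_{a=0}^1P(Z_{ij}=a)\int\mathscr G(s)\{a-\mu_j(s)\}g_j(s|a)\,ds,$$ $$q_1(a,b)=\iint w f(s,t|a,b)\,dt\,ds,\qquad q_2(a,b)=-\iint w\,\tfrac{-\partial\mathscr F(s,t|a,b)}{\partial t}\lambda^0_j(s|a)\,dt\,ds,$$ $$q_3(a,b)=-\iint w\,\tfrac{-\partial\mathscr F(s,t|a,b)}{\partial s}\lambda^0_l(t|b)\,dt\,ds,\qquad q_4(a,b)=\iint w\,\mathscr F(s,t|a,b)\lambda^0_j(s|a)\lambda^0_l(t|b)\,dt\,ds,$$ $$\Upsilon_0^{H_c}(j)=\sum_{a}P(Z_{ij}=a)\{q_0(a)+r_0(a)\}-e_j^2,\qquad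 \Upsilon_1^{H_c}(j,l)=\sum_{a,b}P(Z_{ij}=a,Z_{il}=b)\sum_{r=1}^4q_r(a,b)-e_je_l,$$ $$\kappa_w^{H_c}=\frac{\sum_j\Upsilon_1^{H_c}(j,j)}{\sum_j\Upsilon_0^{H_c}(j)},\qquad \kappa_b^{H_c}=\frac{\sum_{j\ne l}\Upsilon_1^{H_c}(j,l)}{(J-1)\sum_j\Upsilon_0^{H_c}(j)}.$$ **Proposition.** For each $c\in\{0,1\}$ the individual scores are square integrable under $H_c$; $\mathrm{Var}_{H_c}\{U_{ijk}(\beta_0)\}=\Upsilon_0^{H_c}(j)$ for all $i,j,k$; $\mathrm{Cov}_{H_c}\{U_{ijk}(\beta_0),U_{ild}(\beta_0)\}=\Upsilon_1^{H_c}(j,l)$ for all $(j,k)\neq(l,d)$ (so $\kappa_w^{H_c}$, $\kappa_b^{H_c}$ are the within-period and between-period generalized intracluster correlations of the score under $H_c$); and $$\mathrm{Var}_{H_c}\{U(\beta_0)\}=\Big\{nm\sum_{j}\Upsilon^{H_c}_0(j)\Big\}\{1+(m-1)\kappa^{H_c}_w+m(J-1)\kappa^{H_c}_b\},$$ that is,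 for the normalized score, $$\mathrm{Var}_{H_c}\Big\{\frac{U(\beta_0)}{nm}\Big\}=\Big\{\frac1{nm}\sum_{j}\Upsilon^{H_c}_0(j)\Big\}\{1+(m-1)\kappa^{H_c}_w+m(J-1)\kappa^{H_c}_b\}.$$ If $\sum_j\Upsilon_0^{H_c}(j)=0$, both equations hold with the convention $x/0=0$ (both sides are zero). For $c=0$, moreover, $\Upsilon_0^{H_0}(j)=\sum_aP(Z_{ij}=a)q_0(a)$ and $\Upsilon_1^{H_0}(j,l)=\sum_{a,b}P(Z_{ij}=a,Z_{il}=b)\sum_{r=1}^4q_r(a,b)$. -/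

import Mathlib

open MeasureTheory ProbabilityTheory Set

/-- The numerical value (`0` control, `1` intervention) of a treatment condition. -/
def trt (a : Bool) : ℝ := if a then 1 else 0

/-- The design and the population distributions of a cross-sectional longitudinal cluster
randomized trial with `J` periods, under one fixed data-generating hypothesis.

* `Cstar` is the maximum follow-up time.
* `alloc` is the law of the treatment sequence `(Z_{i1}, …, Z_{iJ})` of a cluster (stepped wedge
  allocation, or any other randomization schedule).
* `baseHaz j` is the baseline hazard of period `j`.
* `censSurv j s` is the censoring survival function `𝒢(s) = P(C_{ijk} ≥ s)`, and
  `censSurv₂ j l s t` the bivariate one `𝒢(s, t) = P(C_{ijk} ≥ s, C_{ild} ≥ t)`.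
* `pairDens j l a b` is the density of `(T_{ijk}, T_{ild})` given `Z_{ij} = a`, `Z_{il} = b`,
  for two distinct individuals of the same cluster.

That the data really have these laws is said in `IsTrialData`. -/
structure StudyLaw (J : ℕ) where
  Cstar : ℝ
  Cstar_pos : 0 < Cstar
  alloc : PMF (Fin J → Bool)
  baseHaz : Fin J → ℝ → ℝ
  baseHaz_nonneg : ∀ j, ∀ t ∈ Ioc 0 Cstar, 0 ≤ baseHaz j t
  baseHaz_integrable : ∀ j, IntegrableOn (baseHaz j) (Ioc 0 Cstar)
  censSurv : Fin J → ℝ → ℝ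
  censSurv₂ : Fin J → Fin J → ℝ → ℝ → ℝ
  pairDens : Fin J → Fin J → Bool → Bool → ℝ → ℝ → ℝ
  pairDens_nonneg : ∀ j l a b s t, 0 ≤ pairDens j l a b s t
  pairDens_measurable : ∀ j l a b, Measurable (Function.uncurry (pairDens j l a b))

namespace StudyLaw

noncomputable section

variable {J : ℕ} (L : StudyLaw J)

/-- `P(Z_{ij} = a)`. -/
def prob (j : Fin J) (a : Bool) : ℝ :=
  ∑ z : Fin J → Bool, if z j = a then (L.alloc z).toReal else 0

/-- `P(Z_{ij} = a, Z_{il} = b)`. -/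
def prob₂ (j l : Fin J) (a b : Bool) : ℝ :=
  ∑ z : Fin J → Bool, if z j = a ∧ z l = b then (L.alloc z).toReal else 0

/-- The hazard `λ_{0j}(t) exp(β a)` of the period-stratified Cox model. -/
def hazard (β : ℝ) (j : Fin J) (a : Bool) (t : ℝ) : ℝ :=
  L.baseHaz j t * Real.exp (β * trt a)

/-- The survival function `ℱ_j(s | a)` of the period-stratified Cox model. -/
def surv (β : ℝ) (j : Fin J) (a : Bool) (s : ℝ) : ℝ :=
  Real.exp (-∫ u in Ioc 0 s, L.hazard β j a u)

/-- The density `f(s | a)` of the period-stratified Cox model. -/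
def dens (β : ℝ) (j : Fin J) (a : Bool) (s : ℝ) : ℝ :=
  L.hazard β j a s * L.surv β j a s

/-- The bivariate survival function `ℱ(s, t | a, b)`. -/
def pairSurv (j l : Fin J) (a b : Bool) (s t : ℝ) : ℝ :=
  ∫ x in Ici s ×ˢ Ici t, L.pairDens j l a b x.1 x.2

/-! Below, `βc` is the log hazard ratio that generates the data and `β₀` the one at which the
score is evaluated. -/

/-- `m⁻¹ s_j^{(r)}(t; β₀)` in terms of the laws, the at-risk probabilities being those of `βc`. -/
def limS (βc β₀ : ℝ) (r : ℕ) (j : Fin J) (t : ℝ) : ℝ :=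
  L.censSurv j t *
    ∑ a : Bool, L.prob j a * L.surv βc j a t * trt a ^ r * Real.exp (β₀ * trt a)

/-- `μ_j(t) = s_j^{(1)}(t; β₀) / s_j^{(0)}(t; β₀)`. -/
def mu (βc β₀ : ℝ) (j : Fin J) (t : ℝ) : ℝ :=
  L.limS βc β₀ 1 j t / L.limS βc β₀ 0 j t

/-- `q_0(a) = ∫ 𝒢(s) {a - μ_j(s)}² f(s | a) ds`. -/
def q0 (βc β₀ : ℝ) (j : Fin J) (a : Bool) : ℝ :=
  ∫ s in Ioc 0 L.Cstar, L.censSurv j s * (trt a - L.mu βc β₀ j s) ^ 2 * L.dens βc j a s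

/-- The part of the second moment of an individual score that is due to the hazard of the
data, `λ_{0j} exp(βc a)`, not being the hazard of the model, `λ_{0j} exp(β₀ a)`:
`-2 ∫ 𝒢(s) {a - μ_j(s)} A_j(s, a) [f(s | a) - ℱ_j(s | a) λ_{0j}(s) exp(β₀ a)] ds` with
`A_j(s, a) = ∫_{(0, s]} {a - μ_j(u)} λ_{0j}(u) exp(β₀ a) du`. -/
def drift (βc β₀ : ℝ) (j : Fin J) (a : Bool) : ℝ :=
  -2 * ∫ s in Ioc 0 L.Cstar, L.censSurv j s * (trt a - L.mu βc β₀ j s) *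
    (∫ u in Ioc 0 s, (trt a - L.mu βc β₀ j u) * L.hazard β₀ j a u) *
    (L.dens βc j a s - L.surv βc j a s * L.hazard β₀ j a s)

/-- The mean of an individual score given `Z_{ij} = a`:
`∫ 𝒢(s) {a - μ_j(s)} [f(s | a) - ℱ_j(s | a) λ_{0j}(s) exp(β₀ a)] ds`. -/
def condMean (βc β₀ : ℝ) (j : Fin J) (a : Bool) : ℝ :=
  ∫ s in Ioc 0 L.Cstar, L.censSurv j s * (trt a - L.mu βc β₀ j s) *
    (L.dens βc j a s - L.surv βc j a s * L.hazard β₀ j a s)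

/-- The mean of an individual score in period `j`. -/
def scoreMean (βc β₀ : ℝ) (j : Fin J) : ℝ :=
  ∑ a : Bool, L.prob j a * L.condMean βc β₀ j a

/-- `𝒢(s, t) {a - μ_j(s)} {b - μ_l(t)}`. -/
def weight (βc β₀ : ℝ) (j l : Fin J) (a b : Bool) (s t : ℝ) : ℝ :=
  L.censSurv₂ j l s t * (trt a - L.mu βc β₀ j s) * (trt b - L.mu βc β₀ l t)

def q1 (βc β₀ : ℝ) (j l : Fin J) (a b : Bool) : ℝ :=
  ∫ x in Ioc 0 L.Cstar ×ˢ Ioc 0 L.Cstar,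
    L.weight βc β₀ j l a b x.1 x.2 * L.pairDens j l a b x.1 x.2

def q2 (βc β₀ : ℝ) (j l : Fin J) (a b : Bool) : ℝ :=
  -∫ x in Ioc 0 L.Cstar ×ˢ Ioc 0 L.Cstar,
    L.weight βc β₀ j l a b x.1 x.2 *
      (-deriv (fun t => L.pairSurv j l a b x.1 t) x.2) * L.hazard β₀ j a x.1

def q3 (βc β₀ : ℝ) (j l : Fin J) (a b : Bool) : ℝ :=
  -∫ x in Ioc 0 L.Cstar ×ˢ Ioc 0 L.Cstar,
    L.weight βc β₀ j l a b x.1 x.2 *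
      (-deriv (fun s => L.pairSurv j l a b s x.2) x.1) * L.hazard β₀ l b x.2

def q4 (βc β₀ : ℝ) (j l : Fin J) (a b : Bool) : ℝ :=
  ∫ x in Ioc 0 L.Cstar ×ˢ Ioc 0 L.Cstar,
    L.weight βc β₀ j l a b x.1 x.2 *
      L.pairSurv j l a b x.1 x.2 * L.hazard β₀ j a x.1 * L.hazard β₀ l b x.2

/-- `Υ_0(j)`: the marginal variance of an individual score in period `j`. For `βc = β₀` the
terms `drift` and `scoreMean` are zero. -/
def Upsilon0 (βc β₀ : ℝ) (j : Fin J) : ℝ :=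
  ∑ a : Bool, L.prob j a * (L.q0 βc β₀ j a + L.drift βc β₀ j a) - L.scoreMean βc β₀ j ^ 2

/-- `Υ_1(j, l)`: the covariance of the scores of two distinct individuals of a cluster, one in
period `j` and one in period `l`. For `βc = β₀` the term `scoreMean` is zero. -/
def Upsilon1 (βc β₀ : ℝ) (j l : Fin J) : ℝ :=
  ∑ a : Bool, ∑ b : Bool, L.prob₂ j l a b *
      (L.q1 βc β₀ j l a b + L.q2 βc β₀ j l a b + L.q3 βc β₀ j l a b + L.q4 βc β₀ j l a b)
    - L.scoreMean βc β₀ j * L.scoreMean βc β₀ l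

/-- The within-period generalized intracluster correlation. -/
def kappaW (βc β₀ : ℝ) : ℝ :=
  (∑ j, L.Upsilon1 βc β₀ j j) / ∑ j, L.Upsilon0 βc β₀ j

/-- The between-period generalized intracluster correlation. -/
def kappaB (βc β₀ : ℝ) : ℝ :=
  (∑ j, ∑ l, if j ≠ l then L.Upsilon1 βc β₀ j l else 0) /
    (((J : ℝ) - 1) * ∑ j, L.Upsilon0 βc β₀ j)

end

end StudyLaw

/-- `Z i j`, `T i j k`, `C i j k` are the treatment indicators, event times and censoring times
of a trial with `n` independent clusters, `J` periods and `m` individuals per cluster-period,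
whose laws are those of `L` and whose event times follow the period-stratified marginal Cox
model with log hazard ratio `βc`. -/
structure IsTrialData {Ω : Type*} [MeasurableSpace Ω] {J n m : ℕ} (L : StudyLaw J) (βc : ℝ)
    (P : Measure Ω) (Z : Fin n → Fin J → Ω → Bool)
    (T C : Fin n → Fin J → Fin m → Ω → ℝ) : Prop where
  measurable_Z : ∀ i j, Measurable (Z i j)
  measurable_T : ∀ i j k, Measurable (T i j k)
  measurable_C : ∀ i j k, Measurable (C i j k)
  /-- The clusters are independent. -/
  indep_clusters :
    iIndepFun (fun i ω => ((fun j => Z i j ω), (fun j k => T i j k ω), fun j k => C i j k ω)) P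
  /-- Within a cluster, censoring is independent of event times given treatment, and the
  censoring law does not depend on treatment. -/
  indep_cens : ∀ i, IndepFun (fun ω j k => C i j k ω)
    (fun ω => ((fun j => Z i j ω), fun j k => T i j k ω)) P
  law_Z : ∀ i (z : Fin J → Bool), P.real {ω | ∀ j, Z i j ω = z j} = (L.alloc z).toReal
  law_C : ∀ i j k, ∀ s ∈ Ioc 0 L.Cstar, P.real {ω | s ≤ C i j k ω} = L.censSurv j s
  law_C₂ : ∀ i j k l d, (j, k) ≠ (l, d) → ∀ s ∈ Ioc 0 L.Cstar, ∀ t ∈ Ioc 0 L.Cstar,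
    P.real {ω | s ≤ C i j k ω ∧ t ≤ C i l d ω} = L.censSurv₂ j l s t
  /-- The marginal Cox model: `P(T_{ijk} ≥ s | Z_{ij} = a) = ℱ_j(s | a)`. -/
  law_T : ∀ i j k a, ∀ s ∈ Icc 0 L.Cstar,
    P.real {ω | s ≤ T i j k ω ∧ Z i j ω = a} = L.prob j a * L.surv βc j a s
  /-- Given `Z_{ij} = a` and `Z_{il} = b`, the pair `(T_{ijk}, T_{ild})` has density
  `pairDens j l a b`. -/
  law_T₂ : ∀ i j k l d, (j, k) ≠ (l, d) → ∀ a b, ∀ B : Set (ℝ × ℝ), MeasurableSet B →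
    P.real {ω | (T i j k ω, T i l d ω) ∈ B ∧ Z i j ω = a ∧ Z i l ω = b} =
      L.prob₂ j l a b * ∫ x in B, L.pairDens j l a b x.1 x.2

noncomputable section

/-- The observed at-risk indicator `𝕀(T ≥ t) 𝕀(C ≥ t)`. -/
def atRisk (T C t : ℝ) : ℝ := if t ≤ T ∧ t ≤ C then 1 else 0

variable {Ω : Type*} [MeasurableSpace Ω] {J n m : ℕ}

/-- `s_j^{(r)}(t; β₀) = E{∑ₖ Ȳ_{ijk}(t) Z_{ij}^r exp(β₀ Z_{ij})}`, the expectation being under the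
law `P` of the data (for cluster `i`; all clusters have the same value). -/
def expS (P : Measure Ω) (Z : Fin n → Fin J → Ω → Bool)
    (T C : Fin n → Fin J → Fin m → Ω → ℝ) (β₀ : ℝ) (r : ℕ) (i : Fin n) (j : Fin J) (t : ℝ) : ℝ :=
  ∫ ω, ∑ k, atRisk (T i j k ω) (C i j k ω) t * trt (Z i j ω) ^ r *
    Real.exp (β₀ * trt (Z i j ω)) ∂P

/-- The null score of individual `k` of cluster `i` in period `j`,
`U_{ijk}(β₀) = ∫_{(0, C*]} Ȳ_{ijk}(t) {Z_{ij} - s_j^{(1)}(t; β₀) / s_j^{(0)}(t; β₀)} dM_{ijk}(t)`,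
where `dM_{ijk}(t) = dN_{ijk}(t) - Ȳ_{ijk}(t) λ_{0j}(t) exp(β₀ Z_{ij}) dt`. Integration against the
counting process `N_{ijk}(t) = 𝕀(T_{ijk} ≤ t)` is integration against the unit mass at `T_{ijk}`. -/
def indivScore (L : StudyLaw J) (P : Measure Ω) (Z : Fin n → Fin J → Ω → Bool)
    (T C : Fin n → Fin J → Fin m → Ω → ℝ) (β₀ : ℝ) (i : Fin n) (j : Fin J) (k : Fin m)
    (ω : Ω) : ℝ :=
  (∫ t in Ioc 0 L.Cstar, atRisk (T i j k ω) (C i j k ω) t *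
      (trt (Z i j ω) - expS P Z T C β₀ 1 i j t / expS P Z T C β₀ 0 i j t)
      ∂(Measure.dirac (T i j k ω))) -
  ∫ t in Ioc 0 L.Cstar, atRisk (T i j k ω) (C i j k ω) t *
      (trt (Z i j ω) - expS P Z T C β₀ 1 i j t / expS P Z T C β₀ 0 i j t) *
      L.hazard β₀ j (Z i j ω) t

/-- The null score `U(β₀) = ∑ᵢ ∑ⱼ ∑ₖ U_{ijk}(β₀)`. -/
def totalScore (L : StudyLaw J) (P : Measure Ω) (Z : Fin n → Fin J → Ω → Bool)
    (T C : Fin n → Fin J → Fin m → Ω → ℝ) (β₀ : ℝ) (ω : Ω) : ℝ :=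
  ∑ i, ∑ j, ∑ k, indivScore L P Z T C β₀ i j k ω

end

/-!
The score of an individual is a jump at the observed event time minus a compensator:
`U = jumpPart - compPart`, where `jumpPart` is `Z - μ(T)` if the event is observed on `(0, C*]`, and
`compPart` is the rate `φ = (Z - μ) λ₀ exp(β₀ Z)` accumulated up to the exit time `min T C`
(`indivScore_eq`). Both are bounded, since `μ` takes values in `[0, 1]` and `λ₀` is integrable, so all
moments exist. The moments are computed on each event `Z_{ij} = a`, or `Z_{ij} = a, Z_{il} = b`, and
summed.

*Moments.* By Fubini's theorem the time integral in a compensator is exchanged with the expectation.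
By independence of the censoring times, what remains of the censoring is a factor `𝒢(s)` or `𝒢(s, t)`
(`IndepFun.setIntegral_mul_indicator`). Each jump then contributes a density, and each compensator a
survival probability. For one individual, the square of the compensator is again a compensator: with
`A` the primitive of `φ` it has the rate `2 A φ` (`compPart_sq`); together with the cross term
`-2 (Z - μ) A` at the jump this gives `q0 + drift` (`setIntegral_indivScore_sq`). For two individuals,
the four products of jumps and compensators give `q1`, …, `q4` (`setIntegral_indivScore_mul`).

*Where the hypotheses on the laws enter.* The survival function determines the law of the event time
on `(0, C*)` only. An atom at `C*` is excluded by the joint density with an event time of another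
period (`measure_event_eq_zero`). As the baseline hazard is merely integrable, the density is
recovered from the survival function by the fundamental theorem of calculus for absolutely continuous
functions (`integral_deriv_comp_primitive`), and the partial derivatives of the bivariate survival
function in `q2` and `q3` exist almost everywhere, by Lebesgue's differentiation theorem
(`ae_deriv_bivariateSurvival`). The pair density is integrable only if the joint treatment
probability is positive; otherwise its contribution is multiplied by `0`.

*Total score.* The variance of a sum over independent clusters is the sum of the variances, and each
of these expands into the covariances just computed. If the marginal variances sum to `0`, every
score is almost surely constant.
-/

/-! ### Calculus: primitives and bivariate survival functions -/

theorem ContDiff.comp_absolutelyContinuousOnInterval {g f : ℝ → ℝ} {a b : ℝ}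
    (hg : ContDiff ℝ 1 g) (hf : AbsolutelyContinuousOnInterval f a b) :
    AbsolutelyContinuousOnInterval (g ∘ f) a b := by
  obtain ⟨M, hM⟩ := hf.exists_bound
  obtain ⟨K, hK⟩ := hg.contDiffOn.exists_lipschitzOnWith (s := Icc (-M) M) (by decide)
    (convex_Icc _ _) isCompact_Icc
  have hmem : ∀ x ∈ uIcc a b, f x ∈ Icc (-M) M := fun x hx => abs_le.1 (hM x hx)
  rw [absolutelyContinuousOnInterval_iff] at hf ⊢
  intro ε hε
  obtain ⟨δ, hδ, h⟩ := hf (ε / (K + 1)) (by positivity)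
  refine ⟨δ, hδ, fun E hE hlen => ?_⟩
  have h1 := h E hE hlen
  have h2 : ∑ i ∈ Finset.range E.1, Dist.dist ((g ∘ f) (E.2 i).1) ((g ∘ f) (E.2 i).2) ≤
      ∑ i ∈ Finset.range E.1, K * Dist.dist (f (E.2 i).1) (f (E.2 i).2) := by
    refine Finset.sum_le_sum fun i hi => ?_
    have := hE.1 i hi
    exact hK.dist_le_mul _ (hmem _ this.1) _ (hmem _ this.2)
  rw [← Finset.mul_sum] at h2
  have hnn : 0 ≤ ∑ i ∈ Finset.range E.1, Dist.dist (f (E.2 i).1) (f (E.2 i).2) :=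
    Finset.sum_nonneg fun _ _ => dist_nonneg
  rw [lt_div_iff₀ (by positivity)] at h1
  nlinarith

/-- Fundamental theorem of calculus along a primitive: the density `h` need not be continuous. -/
theorem integral_deriv_comp_primitive {g h : ℝ → ℝ} {a b : ℝ}
    (hg : ContDiff ℝ 1 g) (hh : IntervalIntegrable h volume a b) :
    ∫ u in a..b, deriv g (∫ v in a..u, h v) * h u = g (∫ v in a..b, h v) - g 0 := by
  have hac := hh.absolutelyContinuousOnInterval_intervalIntegral (c := a) (by simp)
  have := (hg.comp_absolutelyContinuousOnInterval hac).integral_deriv_eq_sub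
  simp only [Function.comp, intervalIntegral.integral_same] at this
  rw [← this]
  refine intervalIntegral.integral_congr_ae ?_
  filter_upwards [hh.ae_hasDerivAt_integral] with x hx hxm
  have h1 := hx (uIoc_subset_uIcc hxm) a (by simp)
  have h2 : HasDerivAt g (deriv g (∫ v in a..x, h v)) (∫ v in a..x, h v) :=
    (hg.differentiable (by norm_num) _).hasDerivAt
  exact ((h2.comp x h1).deriv).symm

section BivariateSurvival

variable {p : ℝ → ℝ → ℝ}

theorem bivariateSurvival_eq_integral (hp : Integrable (Function.uncurry p)) (s t : ℝ) :
    ∫ x in Ici s ×ˢ Ici t, p x.1 x.2 = ∫ y in Ici t, ∫ x in Ici s, p x y := by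
  have h : IntegrableOn (fun x : ℝ × ℝ => p x.1 x.2) (Ici s ×ˢ Ici t)
      ((volume : Measure ℝ).prod volume) := hp.integrableOn
  rw [Measure.volume_eq_prod, setIntegral_prod _ h]
  rw [IntegrableOn, ← Measure.prod_restrict] at h
  exact integral_integral_swap h

theorem ae_hasDerivAt_bivariateSurvival (hp : Integrable (Function.uncurry p)) (s : ℝ) :
    ∀ᵐ t, HasDerivAt (fun t => ∫ x in Ici s ×ˢ Ici t, p x.1 x.2) (-∫ x in Ici s, p x t) t := by
  have hm : Integrable (fun y => ∫ x in Ici s, p x y) := by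
    have h : Integrable (Function.uncurry p) (((volume : Measure ℝ).restrict (Ici s)).prod
        volume) := hp.mono_measure
      (by rw [Measure.volume_eq_prod]; exact Measure.prod_mono Measure.restrict_le_self le_rfl)
    exact h.integral_prod_right
  filter_upwards [_root_.LocallyIntegrable.ae_hasDerivAt_integral hm.locallyIntegrable] with t ht
  have h1 : (fun t => ∫ x in Ici s ×ˢ Ici t, p x.1 x.2) =
      fun t => (∫ y in Ioi 0, ∫ x in Ici s, p x y) - ∫ y in (0 : ℝ)..t, ∫ x in Ici s, p x y := by
    funext t
    rw [bivariateSurvival_eq_integral hp, integral_Ici_eq_integral_Ioi,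
      ← intervalIntegral.integral_Ioi_sub_Ioi' hm.integrableOn hm.integrableOn]
    ring
  rw [h1]
  exact (ht 0).const_sub _

theorem continuous_bivariateSurvival (hp : Integrable (Function.uncurry p)) :
    Continuous fun q : ℝ × ℝ => ∫ x in Ici q.1 ×ˢ Ici q.2, p x.1 x.2 := by
  have hset : ∀ q : ℝ × ℝ, MeasurableSet (Ici q.1 ×ˢ Ici q.2) := fun q =>
    measurableSet_Ici.prod measurableSet_Ici
  have heq : (fun q : ℝ × ℝ => ∫ x in Ici q.1 ×ˢ Ici q.2, p x.1 x.2) =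
      fun q => ∫ x, (Ici q.1 ×ˢ Ici q.2).indicator (fun x : ℝ × ℝ => p x.1 x.2) x :=
    funext fun q => (integral_indicator (hset q)).symm
  rw [heq, continuous_iff_continuousAt]
  intro q
  refine continuousAt_of_dominated (bound := fun x : ℝ × ℝ => ‖p x.1 x.2‖)
    (Filter.Eventually.of_forall fun r => (hp.indicator (hset r)).aestronglyMeasurable)
    (Filter.Eventually.of_forall fun r => ae_of_all _ fun x => norm_indicator_le_norm_self _ _)
    hp.norm ?_
  have hfst : ∀ᵐ x : ℝ × ℝ, x.1 ≠ q.1 := by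
    rw [Measure.volume_eq_prod]
    exact Measure.quasiMeasurePreserving_fst.ae (Measure.ae_ne volume q.1)
  have hsnd : ∀ᵐ x : ℝ × ℝ, x.2 ≠ q.2 := by
    rw [Measure.volume_eq_prod]
    exact Measure.quasiMeasurePreserving_snd.ae (Measure.ae_ne volume q.2)
  filter_upwards [hfst, hsnd] with x h1 h2
  -- Off the two boundary lines the indicator is locally constant in the corner of the quadrant.
  have e1 : ∀ᶠ r : ℝ × ℝ in nhds q, (r.1 ≤ x.1 ↔ q.1 ≤ x.1) := by
    rcases lt_or_gt_of_ne h1 with h | h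
    · filter_upwards [continuous_fst.continuousAt.eventually (lt_mem_nhds h)] with r hr
      simp [hr.not_ge, h.not_ge]
    · filter_upwards [continuous_fst.continuousAt.eventually (gt_mem_nhds h)] with r hr
      simp [hr.le, h.le]
  have e2 : ∀ᶠ r : ℝ × ℝ in nhds q, (r.2 ≤ x.2 ↔ q.2 ≤ x.2) := by
    rcases lt_or_gt_of_ne h2 with h | h
    · filter_upwards [continuous_snd.continuousAt.eventually (lt_mem_nhds h)] with r hr
      simp [hr.not_ge, h.not_ge]
    · filter_upwards [continuous_snd.continuousAt.eventually (gt_mem_nhds h)] with r hr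
      simp [hr.le, h.le]
  refine continuousAt_const.congr (f := fun _ => (Ici q.1 ×ˢ Ici q.2).indicator
    (fun x : ℝ × ℝ => p x.1 x.2) x) ?_
  filter_upwards [e1, e2] with r hr1 hr2
  simp only [indicator, mem_prod, mem_Ici, hr1, hr2]

theorem measurable_integral_Ici (hp : Measurable (Function.uncurry p)) :
    Measurable fun q : ℝ × ℝ => ∫ x in Ici q.1, p x q.2 := by
  have h1 : ∀ q : ℝ × ℝ, ∫ x in Ici q.1, p x q.2 = ∫ x, if q.1 ≤ x then p x q.2 else 0 := by
    intro q
    rw [← integral_indicator measurableSet_Ici]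
    simp [indicator]
  simp_rw [h1]
  have : Measurable (Function.uncurry fun (q : ℝ × ℝ) (x : ℝ) =>
      if q.1 ≤ x then p x q.2 else 0) := by
    refine Measurable.ite (measurableSet_le (by fun_prop) (by fun_prop)) ?_ measurable_const
    exact hp.comp (measurable_snd.prodMk (measurable_snd.comp measurable_fst))
  exact (this.stronglyMeasurable.integral_prod_right).measurable

/-- The exceptional set is null in the plane, since it is measurable with null sections. -/
theorem ae_deriv_bivariateSurvival (hpm : Measurable (Function.uncurry p))
    (hp : Integrable (Function.uncurry p)) :
    ∀ᵐ q : ℝ × ℝ, deriv (fun t => ∫ x in Ici q.1 ×ˢ Ici t, p x.1 x.2) q.2 =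
      -∫ x in Ici q.1, p x q.2 := by
  rw [Measure.volume_eq_prod, Measure.ae_prod_iff_ae_ae]
  · exact ae_of_all _ fun s => (ae_hasDerivAt_bivariateSurvival hp s).mono fun t ht => ht.deriv
  · have := measurable_deriv_with_param
      (f := fun s t : ℝ => ∫ x in Ici s ×ˢ Ici t, p x.1 x.2) (continuous_bivariateSurvival hp)
    exact measurableSet_eq_fun this (measurable_integral_Ici hpm).neg

theorem ae_deriv_bivariateSurvival_left (hpm : Measurable (Function.uncurry p))
    (hp : Integrable (Function.uncurry p)) :
    ∀ᵐ q : ℝ × ℝ, deriv (fun s => ∫ x in Ici s ×ˢ Ici q.2, p x.1 x.2) q.1 =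
      -∫ y in Ici q.2, p q.1 y := by
  have hp' : Integrable (Function.uncurry fun s t => p t s) := by
    rw [Measure.volume_eq_prod] at hp ⊢
    exact hp.swap
  have h := ae_deriv_bivariateSurvival (p := fun s t => p t s) (hpm.comp measurable_swap) hp'
  have hq : Measure.QuasiMeasurePreserving (Prod.swap : ℝ × ℝ → ℝ × ℝ) volume volume := by
    rw [Measure.volume_eq_prod]
    exact Measure.measurePreserving_swap.quasiMeasurePreserving
  filter_upwards [hq.ae h] with q h1
  rw [Prod.fst_swap, Prod.snd_swap] at h1
  rw [← h1]
  congr 1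
  funext s
  rw [Measure.volume_eq_prod, ← setIntegral_prod_swap]
  rfl

end BivariateSurvival

noncomputable section

/-! ### Jump and compensator of a score, and independence -/

section ScoreParts

/-- The jump of an individual score: `α` at the event time `t`, if the event is observed, that is,
if it falls into `(0, c]` and not after the censoring time `y`. -/
def jumpPart (c : ℝ) (α : ℝ → ℝ) (t y : ℝ) : ℝ := if t ∈ Ioc 0 c ∧ t ≤ y then α t else 0

/-- The compensator of an individual score: the rate `φ` accumulated over `(0, c]` while at
risk. -/
def compPart (c : ℝ) (φ : ℝ → ℝ) (t y : ℝ) : ℝ := ∫ u in Ioc 0 c, atRisk t y u * φ u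

variable {c : ℝ} {α φ : ℝ → ℝ}

theorem measurable_jumpPart (hα : Measurable α) :
    Measurable fun x : ℝ × ℝ => jumpPart c α x.1 x.2 := by
  refine Measurable.ite ?_ (hα.comp measurable_fst) measurable_const
  exact (measurable_fst measurableSet_Ioc).inter (measurableSet_le measurable_fst measurable_snd)

theorem abs_jumpPart_le {M : ℝ} (hα : ∀ t ∈ Ioc 0 c, |α t| ≤ M) (hM : 0 ≤ M) (t y : ℝ) :
    |jumpPart c α t y| ≤ M := by
  unfold jumpPart
  split_ifs with h
  · exact hα _ h.1
  · simpa using hM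

theorem jumpPart_mul_jumpPart (β : ℝ → ℝ) (t y : ℝ) :
    jumpPart c α t y * jumpPart c β t y = jumpPart c (fun u => α u * β u) t y := by
  unfold jumpPart
  split_ifs <;> simp

theorem jumpPart_congr {β : ℝ → ℝ} (h : EqOn α β (Ioc 0 c)) (t y : ℝ) :
    jumpPart c α t y = jumpPart c β t y := by
  unfold jumpPart
  split_ifs with h1
  · exact h h1.1
  · rfl

theorem abs_atRisk_le (t y u : ℝ) : |atRisk t y u| ≤ 1 := by
  unfold atRisk; split_ifs <;> simp

theorem measurable_atRisk : Measurable fun x : (ℝ × ℝ) × ℝ => atRisk x.1.1 x.1.2 x.2 := by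
  refine Measurable.ite ?_ measurable_const measurable_const
  exact (measurableSet_le (f := fun x : (ℝ × ℝ) × ℝ => x.2) (g := fun x => x.1.1) (by fun_prop)
    (by fun_prop)).inter (measurableSet_le (f := fun x : (ℝ × ℝ) × ℝ => x.2) (g := fun x => x.1.2)
      (by fun_prop) (by fun_prop))

/-- The compensator is a continuous function of the exit time `min t y`. -/
theorem compPart_eq_primitive (t y : ℝ) :
    compPart c φ t y = ∫ u in (0 : ℝ)..min t y, (Ioc 0 c).indicator φ u := by
  unfold compPart
  rw [← integral_indicator measurableSet_Ioc]
  rcases le_total 0 (min t y) with h | h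
  · rw [intervalIntegral.integral_of_le h, ← integral_indicator measurableSet_Ioc]
    congr 1
    funext u
    simp only [indicator, mem_Ioc, atRisk, le_min_iff]
    grind
  · rw [intervalIntegral.integral_of_ge h, ← integral_indicator measurableSet_Ioc]
    have h1 : (Ioc 0 c).indicator (fun u => atRisk t y u * φ u) = 0 := by
      funext u
      simp only [indicator, mem_Ioc, atRisk, ← le_min_iff, Pi.zero_apply]
      grind
    have h2 : (Ioc (min t y) 0).indicator ((Ioc 0 c).indicator φ) = 0 := by
      funext u
      simp only [indicator, mem_Ioc, Pi.zero_apply]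
      grind
    simp [h1, h2]

theorem continuous_primitive_indicator (hφ : IntegrableOn φ (Ioc 0 c)) :
    Continuous fun x => ∫ u in (0 : ℝ)..x, (Ioc 0 c).indicator φ u :=
  intervalIntegral.continuous_primitive
    (fun _ _ => (hφ.integrable_indicator measurableSet_Ioc).intervalIntegrable) 0

theorem primitive_indicator_eq {x : ℝ} (hx : x ∈ Icc 0 c) :
    ∫ u in (0 : ℝ)..x, (Ioc 0 c).indicator φ u = ∫ u in Ioc 0 x, φ u := by
  rw [intervalIntegral.integral_of_le hx.1]
  refine setIntegral_congr_fun measurableSet_Ioc fun u hu => ?_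
  have hu' : u ∈ Ioc 0 c := ⟨hu.1, hu.2.trans hx.2⟩
  exact indicator_of_mem hu' φ

theorem measurable_compPart (hφ : IntegrableOn φ (Ioc 0 c)) :
    Measurable fun x : ℝ × ℝ => compPart c φ x.1 x.2 := by
  simp_rw [compPart_eq_primitive]
  exact ((continuous_primitive_indicator hφ).comp
    ((continuous_fst (X := ℝ) (Y := ℝ)).min continuous_snd)).measurable

theorem abs_compPart_le (hφ : IntegrableOn φ (Ioc 0 c)) (t y : ℝ) :
    |compPart c φ t y| ≤ ∫ u in Ioc 0 c, |φ u| := by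
  unfold compPart
  rw [← Real.norm_eq_abs]
  refine norm_integral_le_of_norm_le hφ.abs (ae_of_all _ fun u => ?_)
  rw [Real.norm_eq_abs, abs_mul]
  exact mul_le_of_le_one_left (abs_nonneg _) (abs_atRisk_le _ _ _)

theorem abs_primitive_indicator_le (hφ : IntegrableOn φ (Ioc 0 c)) (x : ℝ) :
    |∫ u in (0 : ℝ)..x, (Ioc 0 c).indicator φ u| ≤ ∫ u in Ioc 0 c, |φ u| := by
  simpa [compPart_eq_primitive] using abs_compPart_le hφ x x

theorem jumpPart_mul_compPart (t y : ℝ) :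
    jumpPart c α t y * compPart c φ t y =
      jumpPart c (fun s => α s * ∫ u in Ioc 0 s, φ u) t y := by
  unfold jumpPart
  split_ifs with h
  · rw [compPart_eq_primitive, min_eq_left h.2, primitive_indicator_eq (Ioc_subset_Icc_self h.1)]
  · simp

/-- With `A` the primitive of `φ`, the square of the compensator is the compensator for the rate
`2 A φ`, since `d(A²) = 2 A dA`. -/
theorem compPart_sq (hφ : IntegrableOn φ (Ioc 0 c)) (t y : ℝ) :
    compPart c φ t y ^ 2 =
      compPart c (fun u => 2 * (∫ v in Ioc 0 u, φ v) * φ u) t y := by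
  have h := integral_deriv_comp_primitive (g := fun x : ℝ => x ^ 2) (a := 0) (b := min t y)
    (by fun_prop)
    (hφ.integrable_indicator measurableSet_Ioc).intervalIntegrable
  rw [compPart_eq_primitive, compPart_eq_primitive]
  simp only [ne_eq, OfNat.ofNat_ne_zero, not_false_eq_true, zero_pow, sub_zero] at h
  rw [← h]
  refine intervalIntegral.integral_congr fun u _ => ?_
  by_cases hu : u ∈ Ioc 0 c
  · simp only [indicator_of_mem hu, primitive_indicator_eq (Ioc_subset_Icc_self hu)]
    simp
  · simp [indicator_of_notMem hu]

end ScoreParts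

section Decoupling

variable {Ω : Type*} [MeasurableSpace Ω] {P : Measure Ω} [IsProbabilityMeasure P]

theorem ProbabilityTheory.IndepFun.integral_comp_eq {E F : Type*} [MeasurableSpace E]
    [MeasurableSpace F] {Y : Ω → E} {W : Ω → F} (h : IndepFun Y W P) (hY : Measurable Y)
    (hW : Measurable W) {f : E × F → ℝ} (hf : Measurable f) {M : ℝ} (hM : ∀ x, |f x| ≤ M) :
    ∫ ω, f (Y ω, W ω) ∂P = ∫ ω, ∫ ω', f (Y ω', W ω) ∂P ∂P := by
  have := Measure.isProbabilityMeasure_map hY.aemeasurable (μ := P)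
  have := Measure.isProbabilityMeasure_map hW.aemeasurable (μ := P)
  have hint : Integrable f ((P.map Y).prod (P.map W)) :=
    Integrable.of_bound hf.aestronglyMeasurable M (ae_of_all _ hM)
  rw [← integral_map (φ := fun ω => (Y ω, W ω)) (hY.prodMk hW).aemeasurable
      hf.aestronglyMeasurable,
    (indepFun_iff_map_prod_eq_prod_map_map hY.aemeasurable hW.aemeasurable).1 h,
    integral_prod_symm _ hint, integral_map hW.aemeasurable
      hint.integral_prod_right.aestronglyMeasurable]
  refine integral_congr_ae (ae_of_all _ fun ω => ?_)
  exact integral_map hY.aemeasurable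
    (hf.comp (measurable_id.prodMk measurable_const)).aestronglyMeasurable

/-- An event that involves `Y` may be replaced by its probability given the value of an
independent `W`. -/
theorem ProbabilityTheory.IndepFun.setIntegral_mul_indicator {E F : Type*} [MeasurableSpace E]
    [MeasurableSpace F] {Y : Ω → E} {W : Ω → F} (h : IndepFun Y W P) (hY : Measurable Y)
    (hW : Measurable W) {S : Set F} (hS : MeasurableSet S) {H : F → ℝ} (hH : Measurable H) {M : ℝ}
    (hM : ∀ x, |H x| ≤ M) {A : Set (E × F)} (hA : MeasurableSet A) :
    ∫ ω in W ⁻¹' S, H (W ω) * A.indicator 1 (Y ω, W ω) ∂P =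
      ∫ ω in W ⁻¹' S, H (W ω) * P.real {ω' | (Y ω', W ω) ∈ A} ∂P := by
  have hf : Measurable fun x : E × F => S.indicator H x.2 * A.indicator 1 x :=
    ((hH.indicator hS).comp measurable_snd).mul (measurable_one.indicator hA)
  have hb : ∀ x : E × F, |S.indicator H x.2 * A.indicator 1 x| ≤ M := by
    intro x
    have h0 := hM x.2
    have h1 : |S.indicator H x.2| ≤ M := by
      by_cases hx : x.2 ∈ S
      · simpa [hx] using h0
      · simpa [hx] using (abs_nonneg _).trans h0
    by_cases hx : x ∈ A
    · simpa [hx] using h1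
    · simpa [hx] using (abs_nonneg _).trans h0
  have key := h.integral_comp_eq hY hW hf hb
  rw [← integral_indicator (hW hS), ← integral_indicator (hW hS)]
  have e1 : ∀ ω, (W ⁻¹' S).indicator (fun ω => H (W ω) * A.indicator 1 (Y ω, W ω)) ω =
      S.indicator H (W ω) * A.indicator 1 (Y ω, W ω) := by
    intro ω
    by_cases hω : W ω ∈ S
    · rw [indicator_of_mem (by exact hω), indicator_of_mem hω]
    · rw [indicator_of_notMem (by exact hω), indicator_of_notMem hω, zero_mul]
  simp_rw [e1]
  rw [key]
  refine integral_congr_ae (ae_of_all _ fun ω => ?_)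
  have e2 : ∫ ω', A.indicator (1 : E × F → ℝ) (Y ω', W ω) ∂P = P.real {ω' | (Y ω', W ω) ∈ A} := by
    have hms : MeasurableSet {ω' | (Y ω', W ω) ∈ A} := (hY.prodMk measurable_const) hA
    rw [← integral_indicator_one hms]
    rfl
  simp only [integral_const_mul, e2]
  by_cases hω : W ω ∈ S
  · rw [indicator_of_mem hω, indicator_of_mem (mem_preimage.2 hω)]
  · rw [indicator_of_notMem hω, indicator_of_notMem (by exact hω), zero_mul]

theorem measurable_survival₂ {Y Y' : Ω → ℝ} (hY : Measurable Y) (hY' : Measurable Y') :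
    Measurable fun q : ℝ × ℝ => P.real {ω | q.1 ≤ Y ω ∧ q.2 ≤ Y' ω} := by
  have hs : MeasurableSet {x : (ℝ × ℝ) × Ω | x.1.1 ≤ Y x.2 ∧ x.1.2 ≤ Y' x.2} :=
    (measurableSet_le (by fun_prop) (hY.comp measurable_snd)).inter
      (measurableSet_le (by fun_prop) (hY'.comp measurable_snd))
  exact (measurable_measure_prodMk_left hs).ennreal_toReal

theorem measurable_survival {Y : Ω → ℝ} (hY : Measurable Y) :
    Measurable fun s : ℝ => P.real {ω | s ≤ Y ω} := by
  have hs : MeasurableSet {x : ℝ × Ω | x.1 ≤ Y x.2} :=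
    measurableSet_le (by fun_prop) (hY.comp measurable_snd)
  exact (measurable_measure_prodMk_left hs).ennreal_toReal

end Decoupling

/-! ### Moments of censored scores on an event -/

section Pair

variable {Ω : Type*} [MeasurableSpace Ω]

/-- The bivariate survival function `P(Y ≥ s, Y' ≥ t)`. -/
def jointSurvival (P : Measure Ω) (Y Y' : Ω → ℝ) (s t : ℝ) : ℝ :=
  P.real {ω | s ≤ Y ω ∧ t ≤ Y' ω}

theorem abs_jointSurvival_le (P : Measure Ω) [IsProbabilityMeasure P] (Y Y' : Ω → ℝ) (s t : ℝ) :
    |jointSurvival P Y Y' s t| ≤ 1 := by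
  unfold jointSurvival
  rw [abs_of_nonneg measureReal_nonneg]
  exact measureReal_le_one

/-- Given the event `E`, of probability `π`, the event times `X`, `X'` have joint density `p` and are
independent of the censoring times `Y`, `Y'`, whose law is not affected by `E`. The field `law`
combines these statements: it tests `X`, `X'` with a bounded function `H` and censors at times
`σ`, `τ` that may be fixed or depend on `X`, `X'`. -/
structure IsCensoredPair (P : Measure Ω) (E : Set Ω) (X X' Y Y' : Ω → ℝ) (π : ℝ)
    (p : ℝ → ℝ → ℝ) : Prop where
  measurable_X : Measurable X
  measurable_X' : Measurable X'
  measurable_Y : Measurable Y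
  measurable_Y' : Measurable Y'
  measurable_dens : Measurable (Function.uncurry p)
  nonneg_dens : ∀ s t, 0 ≤ p s t
  integrable_dens : Integrable (Function.uncurry p)
  law : ∀ (H σ τ : ℝ × ℝ → ℝ) (M : ℝ), Measurable H → (∀ x, |H x| ≤ M) → Measurable σ →
    Measurable τ →
    ∫ ω in E, H (X ω, X' ω) *
      (if σ (X ω, X' ω) ≤ Y ω ∧ τ (X ω, X' ω) ≤ Y' ω then 1 else 0) ∂P =
    π * ∫ x, H x * jointSurvival P Y Y' (σ x) (τ x) * p x.1 x.2

namespace IsCensoredPair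

variable {P : Measure Ω} {E : Set Ω} {X X' Y Y' : Ω → ℝ} {π : ℝ} {p : ℝ → ℝ → ℝ} {c : ℝ}
  {α β φ ψ : ℝ → ℝ}

theorem swap (h : IsCensoredPair P E X X' Y Y' π p) :
    IsCensoredPair P E X' X Y' Y π (fun s t => p t s) where
  measurable_X := h.measurable_X'
  measurable_X' := h.measurable_X
  measurable_Y := h.measurable_Y'
  measurable_Y' := h.measurable_Y
  measurable_dens := h.measurable_dens.comp measurable_swap
  nonneg_dens s t := h.nonneg_dens t s
  integrable_dens := by
    have := h.integrable_dens
    rw [Measure.volume_eq_prod] at this ⊢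
    exact this.swap
  law H σ τ M hH hM hσ hτ := by
    have := h.law (H ∘ Prod.swap) (τ ∘ Prod.swap) (σ ∘ Prod.swap) M (hH.comp measurable_swap)
      (fun x => hM _) (hτ.comp measurable_swap) (hσ.comp measurable_swap)
    simp only [Function.comp, Prod.swap_prod_mk] at this
    simp only [and_comm (a := σ _ ≤ _)]
    rw [this, Measure.volume_eq_prod, ← integral_prod_swap]
    simp only [jointSurvival, and_comm, Prod.swap_swap, Prod.fst_swap, Prod.snd_swap]

/-- Jump against jump: the joint density remains. -/
theorem integral_jump_mul_jump (h : IsCensoredPair P E X X' Y Y' π p) (hα : Measurable α)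
    (hβ : Measurable β) (hαM : ∀ t, |α t| ≤ 1) (hβM : ∀ t, |β t| ≤ 1) :
    ∫ ω in E, jumpPart c α (X ω) (Y ω) * jumpPart c β (X' ω) (Y' ω) ∂P =
      π * ∫ x in Ioc 0 c ×ˢ Ioc 0 c,
        jointSurvival P Y Y' x.1 x.2 * α x.1 * β x.2 * p x.1 x.2 := by
  have hs : MeasurableSet (Ioc 0 c ×ˢ Ioc 0 c) := measurableSet_Ioc.prod measurableSet_Ioc
  have key := h.law ((Ioc 0 c ×ˢ Ioc 0 c).indicator fun x => α x.1 * β x.2) Prod.fst Prod.snd 1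
    (((hα.comp measurable_fst).mul (hβ.comp measurable_snd)).indicator hs)
    (fun x => by
      rw [← Real.norm_eq_abs]
      refine (norm_indicator_le_norm_self _ _).trans ?_
      rw [Real.norm_eq_abs, abs_mul]
      exact mul_le_one₀ (hαM _) (abs_nonneg _) (hβM _)) measurable_fst measurable_snd
  rw [← integral_indicator hs]
  convert key using 2
  · funext ω
    by_cases h1 : X ω ∈ Ioc 0 c <;> by_cases h2 : X' ω ∈ Ioc 0 c <;>
      by_cases h3 : X ω ≤ Y ω <;> by_cases h4 : X' ω ≤ Y' ω <;> simp [jumpPart, h1, h2, h3, h4]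
  · refine integral_congr_ae (ae_of_all _ fun x => ?_)
    by_cases hx : x ∈ Ioc 0 c ×ˢ Ioc 0 c
    · simp only [indicator_of_mem hx]; ring
    · simp [indicator_of_notMem hx]

variable [IsProbabilityMeasure P]

/-- Compensator against jump: the first event time enters through the event `X ≥ s` only, which
leaves the tail integral of the joint density in its first variable. -/
theorem integral_comp_mul_jump (h : IsCensoredPair P E X X' Y Y' π p)
    (hφ : IntegrableOn φ (Ioc 0 c)) (hβ : Measurable β) (hβM : ∀ t, |β t| ≤ 1) :
    ∫ ω in E, compPart c φ (X ω) (Y ω) * jumpPart c β (X' ω) (Y' ω) ∂P =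
      π * ∫ x in Ioc 0 c ×ˢ Ioc 0 c,
        jointSurvival P Y Y' x.1 x.2 * φ x.1 * β x.2 * ∫ s in Ici x.1, p s x.2 := by
  have hX := h.measurable_X
  have hX' := h.measurable_X'
  have hY := h.measurable_Y
  have hY' := h.measurable_Y'
  have hG : Measurable fun q : ℝ × ℝ => jointSurvival P Y Y' q.1 q.2 := measurable_survival₂ hY hY'
  have hβ' := (measurable_jumpPart (c := c) hβ).comp (hX'.prodMk hY')
  -- exchange of the expectation with the time integral of the compensator
  have hint : Integrable (fun x : Ω × ℝ => atRisk (X x.1) (Y x.1) x.2 * φ x.2 *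
      jumpPart c β (X' x.1) (Y' x.1)) ((P.restrict E).prod (volume.restrict (Ioc 0 c))) := by
    have h1 : Integrable (fun x : Ω × ℝ => φ x.2)
      ((P.restrict E).prod (volume.restrict (Ioc 0 c))) := Integrable.comp_snd hφ _
    have h2 : Measurable fun x : Ω × ℝ =>
        atRisk (X x.1) (Y x.1) x.2 * jumpPart c β (X' x.1) (Y' x.1) :=
      (measurable_atRisk.comp (((hX.prodMk hY).comp measurable_fst).prodMk measurable_snd)).mul
        (hβ'.comp measurable_fst)
    have h3 := h1.bdd_mul (c := 1) h2.aestronglyMeasurable (ae_of_all _ fun x => by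
      rw [Real.norm_eq_abs, abs_mul]
      exact mul_le_one₀ (abs_atRisk_le _ _ _) (abs_nonneg _)
        (abs_jumpPart_le (fun t _ => hβM t) zero_le_one _ _))
    refine h3.congr (ae_of_all _ fun x => ?_)
    simp only
    ring
  have hswap : ∫ ω in E, compPart c φ (X ω) (Y ω) * jumpPart c β (X' ω) (Y' ω) ∂P =
      ∫ u in Ioc 0 c, ∫ ω in E, atRisk (X ω) (Y ω) u * φ u * jumpPart c β (X' ω) (Y' ω) ∂P := by
    rw [← integral_integral_swap hint]
    simp_rw [compPart, ← integral_mul_const]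
  have hinner : ∀ u, ∫ ω in E, atRisk (X ω) (Y ω) u * φ u * jumpPart c β (X' ω) (Y' ω) ∂P =
      π * ∫ y in Ioc 0 c, jointSurvival P Y Y' u y * φ u * β y * ∫ s in Ici u, p s y := by
    intro u
    have hs : MeasurableSet (Ici u ×ˢ Ioc 0 c) := measurableSet_Ici.prod measurableSet_Ioc
    have key := h.law ((Ici u ×ˢ Ioc 0 c).indicator fun x => β x.2) (fun _ => u) Prod.snd 1
      ((hβ.comp measurable_snd).indicator hs)
      (fun x => by
        rw [← Real.norm_eq_abs]
        exact (norm_indicator_le_norm_self _ _).trans (hβM _)) measurable_const measurable_snd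
    have e1 : ∫ ω in E, atRisk (X ω) (Y ω) u * φ u * jumpPart c β (X' ω) (Y' ω) ∂P =
        φ u * ∫ ω in E, (Ici u ×ˢ Ioc 0 c).indicator (fun x => β x.2) (X ω, X' ω) *
          (if u ≤ Y ω ∧ X' ω ≤ Y' ω then 1 else 0) ∂P := by
      rw [← integral_const_mul]
      congr 1
      funext ω
      by_cases h1 : u ≤ X ω <;> by_cases h2 : X' ω ∈ Ioc 0 c <;>
        by_cases h3 : u ≤ Y ω <;> by_cases h4 : X' ω ≤ Y' ω <;>
        simp [jumpPart, atRisk, h1, h2, h3, h4]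
    have hi : IntegrableOn (fun x : ℝ × ℝ => jointSurvival P Y Y' u x.2 * β x.2 * p x.1 x.2)
        (Ici u ×ˢ Ioc 0 c) (volume.prod volume) := by
      refine (h.integrable_dens.bdd_mul (c := 1) ?_ (ae_of_all _ fun x => ?_)).integrableOn
      · exact ((hG.comp (measurable_const.prodMk measurable_snd)).mul
          (hβ.comp measurable_snd)).aestronglyMeasurable
      · rw [Real.norm_eq_abs, abs_mul]
        exact mul_le_one₀ (abs_jointSurvival_le P Y Y' _ _) (abs_nonneg _) (hβM _)
    have e2 : ∫ x, (Ici u ×ˢ Ioc 0 c).indicator (fun x => β x.2) x *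
          jointSurvival P Y Y' u x.2 * p x.1 x.2 =
        ∫ y in Ioc 0 c, jointSurvival P Y Y' u y * β y * ∫ s in Ici u, p s y := by
      have : ∀ x : ℝ × ℝ, (Ici u ×ˢ Ioc 0 c).indicator (fun x => β x.2) x *
          jointSurvival P Y Y' u x.2 * p x.1 x.2 =
          (Ici u ×ˢ Ioc 0 c).indicator
            (fun x => jointSurvival P Y Y' u x.2 * β x.2 * p x.1 x.2) x := by
        intro x
        by_cases hx : x ∈ Ici u ×ˢ Ioc 0 c
        · simp only [indicator_of_mem hx]; ring
        · simp [indicator_of_notMem hx]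
      simp_rw [this]
      rw [integral_indicator hs, Measure.volume_eq_prod, setIntegral_prod _ hi,
        integral_integral_swap (by
          rw [IntegrableOn, ← Measure.prod_restrict] at hi
          exact hi)]
      simp_rw [integral_const_mul]
    rw [e1, key, e2, mul_left_comm, ← integral_const_mul]
    congr 2
    funext y
    ring
  rw [hswap]
  simp_rw [hinner]
  rw [integral_const_mul, Measure.volume_eq_prod, setIntegral_prod]
  -- integrability on the square: the tail integral is bounded by the marginal density
  have hm : Integrable (fun y => ∫ s, p s y) := by
    have := h.integrable_dens
    rw [Measure.volume_eq_prod] at this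
    exact this.integral_prod_right
  have hb : Integrable (fun x : ℝ × ℝ => φ x.1 * ∫ s, p s x.2)
      ((volume.restrict (Ioc 0 c)).prod (volume.restrict (Ioc 0 c))) :=
    Integrable.mul_prod hφ hm.integrableOn
  have hsec : ∀ᵐ y, Integrable fun s => p s y := by
    have := h.integrable_dens
    rw [Measure.volume_eq_prod] at this
    exact this.prod_left_ae
  rw [IntegrableOn, ← Measure.prod_restrict]
  refine hb.mono ?_ ?_
  · refine AEStronglyMeasurable.mul (AEStronglyMeasurable.mul (AEStronglyMeasurable.mul ?_ ?_) ?_) ?_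
    · exact hG.aestronglyMeasurable
    · exact hφ.aestronglyMeasurable.comp_fst
    · exact (hβ.comp measurable_snd).aestronglyMeasurable
    · exact (measurable_integral_Ici h.measurable_dens).aestronglyMeasurable
  · have hsec' : ∀ᵐ x : ℝ × ℝ ∂((volume.restrict (Ioc 0 c)).prod (volume.restrict (Ioc 0 c))),
        Integrable fun s => p s x.2 :=
      Measure.quasiMeasurePreserving_snd.ae (ae_restrict_of_ae hsec)
    filter_upwards [hsec'] with x hx
    have h0 : 0 ≤ ∫ s in Ici x.1, p s x.2 := integral_nonneg fun s => h.nonneg_dens _ _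
    have h1 : ∫ s in Ici x.1, p s x.2 ≤ ∫ s, p s x.2 :=
      setIntegral_le_integral hx (ae_of_all _ fun s => h.nonneg_dens _ _)
    rw [Real.norm_eq_abs, Real.norm_eq_abs, abs_mul, abs_mul, abs_mul, abs_mul, abs_of_nonneg h0,
      abs_of_nonneg (h0.trans h1)]
    have h2 := abs_jointSurvival_le P Y Y' x.1 x.2
    have h3 := hβM x.2
    have h4 : |jointSurvival P Y Y' x.1 x.2| * |φ x.1| * |β x.2| ≤ |φ x.1| := by
      calc _ ≤ 1 * |φ x.1| * 1 := by gcongr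
        _ = _ := by ring
    exact mul_le_mul h4 h1 h0 (abs_nonneg _)

theorem integral_jump_mul_comp (h : IsCensoredPair P E X X' Y Y' π p)
    (hα : Measurable α) (hαM : ∀ t, |α t| ≤ 1) (hψ : IntegrableOn ψ (Ioc 0 c)) :
    ∫ ω in E, jumpPart c α (X ω) (Y ω) * compPart c ψ (X' ω) (Y' ω) ∂P =
      π * ∫ x in Ioc 0 c ×ˢ Ioc 0 c,
        jointSurvival P Y Y' x.1 x.2 * α x.1 * ψ x.2 * ∫ t in Ici x.2, p x.1 t := by
  have := h.swap.integral_comp_mul_jump hψ hα hαM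
  simp_rw [mul_comm (jumpPart c α _ _)]
  rw [this, Measure.volume_eq_prod, ← setIntegral_prod_swap]
  congr 2
  funext x
  simp only [jointSurvival, Prod.fst_swap, Prod.snd_swap, and_comm]
  ring

/-- Compensator against compensator: the joint survival function remains. -/
theorem integral_comp_mul_comp (h : IsCensoredPair P E X X' Y Y' π p)
    (hφ : IntegrableOn φ (Ioc 0 c)) (hψ : IntegrableOn ψ (Ioc 0 c)) :
    ∫ ω in E, compPart c φ (X ω) (Y ω) * compPart c ψ (X' ω) (Y' ω) ∂P =
      π * ∫ x in Ioc 0 c ×ˢ Ioc 0 c, jointSurvival P Y Y' x.1 x.2 * φ x.1 * ψ x.2 *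
        ∫ y in Ici x.1 ×ˢ Ici x.2, p y.1 y.2 := by
  have hX := h.measurable_X
  have hX' := h.measurable_X'
  have hY := h.measurable_Y
  have hY' := h.measurable_Y'
  have hint : Integrable (fun z : Ω × (ℝ × ℝ) => (atRisk (X z.1) (Y z.1) z.2.1 * φ z.2.1) *
      (atRisk (X' z.1) (Y' z.1) z.2.2 * ψ z.2.2)) ((P.restrict E).prod
        ((volume.restrict (Ioc 0 c)).prod (volume.restrict (Ioc 0 c)))) := by
    have h1 : Integrable (fun z : Ω × (ℝ × ℝ) => φ z.2.1 * ψ z.2.2) ((P.restrict E).prod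
        ((volume.restrict (Ioc 0 c)).prod (volume.restrict (Ioc 0 c)))) :=
      Integrable.comp_snd (Integrable.mul_prod hφ hψ) _
    have h2 : Measurable fun z : Ω × (ℝ × ℝ) =>
        atRisk (X z.1) (Y z.1) z.2.1 * atRisk (X' z.1) (Y' z.1) z.2.2 :=
      (measurable_atRisk.comp (((hX.prodMk hY).comp measurable_fst).prodMk
        (measurable_fst.comp measurable_snd))).mul
      (measurable_atRisk.comp (((hX'.prodMk hY').comp measurable_fst).prodMk
        (measurable_snd.comp measurable_snd)))
    have h3 := h1.bdd_mul (c := 1) h2.aestronglyMeasurable (ae_of_all _ fun z => by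
      rw [Real.norm_eq_abs, abs_mul]
      exact mul_le_one₀ (abs_atRisk_le _ _ _) (abs_nonneg _) (abs_atRisk_le _ _ _))
    refine h3.congr (ae_of_all _ fun x => ?_)
    simp only
    ring
  have hswap : ∫ ω in E, compPart c φ (X ω) (Y ω) * compPart c ψ (X' ω) (Y' ω) ∂P =
      ∫ x in Ioc 0 c ×ˢ Ioc 0 c, ∫ ω in E, (atRisk (X ω) (Y ω) x.1 * φ x.1) *
        (atRisk (X' ω) (Y' ω) x.2 * ψ x.2) ∂P := by
    rw [Measure.volume_eq_prod, ← Measure.prod_restrict, ← integral_integral_swap hint]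
    simp_rw [compPart, ← integral_prod_mul]
  rw [hswap, ← integral_const_mul]
  congr 1
  funext q
  have hs : MeasurableSet (Ici q.1 ×ˢ Ici q.2) := measurableSet_Ici.prod measurableSet_Ici
  have key := h.law ((Ici q.1 ×ˢ Ici q.2).indicator 1) (fun _ => q.1) (fun _ => q.2) 1
    (measurable_one.indicator hs)
    (fun x => by
      rw [← Real.norm_eq_abs]
      exact (norm_indicator_le_norm_self _ _).trans (by simp)) measurable_const measurable_const
  have e1 : ∫ ω in E, (atRisk (X ω) (Y ω) q.1 * φ q.1) * (atRisk (X' ω) (Y' ω) q.2 * ψ q.2) ∂P =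
      φ q.1 * ψ q.2 * ∫ ω in E, (Ici q.1 ×ˢ Ici q.2).indicator (1 : ℝ × ℝ → ℝ) (X ω, X' ω) *
          (if q.1 ≤ Y ω ∧ q.2 ≤ Y' ω then 1 else 0) ∂P := by
    rw [← integral_const_mul]
    congr 1
    funext ω
    by_cases h1 : q.1 ≤ X ω <;> by_cases h2 : q.2 ≤ X' ω <;>
      by_cases h3 : q.1 ≤ Y ω <;> by_cases h4 : q.2 ≤ Y' ω <;> simp [atRisk, h1, h2, h3, h4, -Ici_prod_Ici]
  have e2 : ∫ x, (Ici q.1 ×ˢ Ici q.2).indicator (1 : ℝ × ℝ → ℝ) x *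
      jointSurvival P Y Y' q.1 q.2 * p x.1 x.2 =
      jointSurvival P Y Y' q.1 q.2 * ∫ y in Ici q.1 ×ˢ Ici q.2, p y.1 y.2 := by
    rw [← integral_indicator hs, ← integral_const_mul]
    congr 1
    funext x
    by_cases hx : x ∈ Ici q.1 ×ˢ Ici q.2
    · simp only [indicator_of_mem hx, Pi.one_apply]; ring
    · simp only [indicator_of_notMem hx, zero_mul, mul_zero]
  rw [e1, key, e2]
  ring

end IsCensoredPair

end Pair

section Single

variable {Ω : Type*} [MeasurableSpace Ω]

/-- Given the event `E`, of probability `π`, the event time `X` has survival function `F` and density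
`f` on `(0, c]` and is independent of the censoring time `Y`, whose law is not affected by `E`. The
fields `law_observed` and `law_atRisk` say so for an observed event and for being at risk. -/
structure IsCensoredTime (P : Measure Ω) (c : ℝ) (E : Set Ω) (X Y : Ω → ℝ) (π : ℝ)
    (F f : ℝ → ℝ) : Prop where
  measurable_X : Measurable X
  measurable_Y : Measurable Y
  law_observed : ∀ (α : ℝ → ℝ) (M : ℝ), Measurable α → (∀ t, |α t| ≤ M) →
    ∫ ω in E, jumpPart c α (X ω) (Y ω) ∂P =
      π * ∫ s in Ioc 0 c, P.real {ω | s ≤ Y ω} * α s * f s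
  law_atRisk : ∀ s ∈ Ioc 0 c, ∫ ω in E, atRisk (X ω) (Y ω) s ∂P =
    π * (P.real {ω | s ≤ Y ω} * F s)

theorem IsCensoredTime.integral_comp {P : Measure Ω} [IsProbabilityMeasure P] {E : Set Ω}
    {X Y : Ω → ℝ} {π c : ℝ} {F f χ : ℝ → ℝ} (h : IsCensoredTime P c E X Y π F f)
    (hχ : IntegrableOn χ (Ioc 0 c)) :
    ∫ ω in E, compPart c χ (X ω) (Y ω) ∂P =
      π * ∫ s in Ioc 0 c, P.real {ω | s ≤ Y ω} * F s * χ s := by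
  have hint : Integrable (fun x : Ω × ℝ => atRisk (X x.1) (Y x.1) x.2 * χ x.2)
      ((P.restrict E).prod (volume.restrict (Ioc 0 c))) := by
    have h1 : Integrable (fun x : Ω × ℝ => χ x.2)
      ((P.restrict E).prod (volume.restrict (Ioc 0 c))) := Integrable.comp_snd hχ _
    have h2 : Measurable fun x : Ω × ℝ => atRisk (X x.1) (Y x.1) x.2 :=
      measurable_atRisk.comp
        (((h.measurable_X.prodMk h.measurable_Y).comp measurable_fst).prodMk measurable_snd)
    exact h1.bdd_mul (c := 1) h2.aestronglyMeasurable (ae_of_all _ fun x => abs_atRisk_le _ _ _)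
  simp_rw [compPart]
  rw [integral_integral_swap hint, ← integral_const_mul]
  refine setIntegral_congr_fun measurableSet_Ioc fun s hs => ?_
  simp only [integral_mul_const, h.law_atRisk s hs]
  ring

end Single

/-! ### The laws of event times in the trial -/

section General

variable {Ω : Type*} [MeasurableSpace Ω] {P : Measure Ω}

theorem integral_eq_sum_setIntegral_fiber {ι : Type*} [Fintype ι] [MeasurableSpace ι]
    [MeasurableSingletonClass ι] {V : Ω → ι} (hV : Measurable V) {f : Ω → ℝ}
    (hf : Integrable f P) : ∫ ω, f ω ∂P = ∑ a, ∫ ω in {ω | V ω = a}, f ω ∂P := by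
  rw [← integral_iUnion_fintype (s := fun a => {ω | V ω = a})
    (fun a => hV (measurableSet_singleton a)) ?_ (fun a => hf.integrableOn)]
  · have : ⋃ a, {ω | V ω = a} = univ := by ext; simp
    rw [this, setIntegral_univ]
  · intro a b hab
    exact Set.disjoint_left.2 fun ω h1 h2 => hab (h1.symm.trans h2)

theorem setIntegral_comp_eq_of_density {F : Type*} [MeasurableSpace F] {ν : Measure F}
    {V : Ω → F} (hV : Measurable V) {S : Set Ω} {g : F → ℝ} (hg : AEMeasurable g ν)
    (hg0 : 0 ≤ᵐ[ν] g)
    (hmap : (P.restrict S).map V = ν.withDensity fun x => ENNReal.ofReal (g x))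
    {H : F → ℝ} (hH : Measurable H) :
    ∫ ω in S, H (V ω) ∂P = ∫ x, g x * H x ∂ν := by
  rw [← integral_map hV.aemeasurable hH.aestronglyMeasurable, hmap,
    integral_withDensity_eq_integral_toReal_smul₀ hg.ennreal_ofReal
      (ae_of_all _ fun _ => ENNReal.ofReal_lt_top)]
  refine integral_congr_ae ?_
  filter_upwards [hg0] with x hx
  simp only [Pi.zero_apply] at hx
  simp [ENNReal.toReal_ofReal hx]

end General

namespace StudyLaw

variable {J : ℕ} (L : StudyLaw J)

theorem prob_nonneg (j : Fin J) (a : Bool) : 0 ≤ L.prob j a :=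
  Finset.sum_nonneg fun z _ => by split_ifs <;> simp

theorem prob₂_nonneg (j l : Fin J) (a b : Bool) : 0 ≤ L.prob₂ j l a b :=
  Finset.sum_nonneg fun z _ => by split_ifs <;> simp

variable (β : ℝ) (j : Fin J) (a : Bool)

theorem integrableOn_hazard : IntegrableOn (L.hazard β j a) (Ioc 0 L.Cstar) :=
  (L.baseHaz_integrable j).mul_const _

theorem hazard_nonneg {t : ℝ} (ht : t ∈ Ioc 0 L.Cstar) : 0 ≤ L.hazard β j a t :=
  mul_nonneg (L.baseHaz_nonneg j t ht) (Real.exp_pos _).le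

theorem surv_pos (s : ℝ) : 0 < L.surv β j a s := Real.exp_pos _

/-- The survival function, continued outside `[0, C*]` by constants. -/
def survExt (s : ℝ) : ℝ :=
  Real.exp (-∫ u in (0 : ℝ)..s, (Ioc 0 L.Cstar).indicator (L.hazard β j a) u)

theorem survExt_eq {s : ℝ} (hs : s ∈ Icc 0 L.Cstar) : L.survExt β j a s = L.surv β j a s := by
  rw [survExt, primitive_indicator_eq hs, surv]

theorem measurable_survExt : Measurable (L.survExt β j a) :=
  (Real.continuous_exp.comp
    (continuous_primitive_indicator (L.integrableOn_hazard β j a)).neg).measurable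

theorem surv_le_one {s : ℝ} (hs : s ∈ Icc 0 L.Cstar) : L.surv β j a s ≤ 1 := by
  rw [surv, Real.exp_le_one_iff, neg_nonpos]
  exact setIntegral_nonneg measurableSet_Ioc fun u hu =>
    L.hazard_nonneg β j a ⟨hu.1, hu.2.trans hs.2⟩

theorem dens_nonneg {t : ℝ} (ht : t ∈ Ioc 0 L.Cstar) : 0 ≤ L.dens β j a t :=
  mul_nonneg (L.hazard_nonneg β j a ht) (L.surv_pos β j a t).le

/-- The survival function may belong to another log hazard ratio than the hazard, as in the drift
terms. -/
theorem integrableOn_mul_surv_mul_hazard {w : ℝ → ℝ} (hw : Measurable w) {M : ℝ}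
    (hM : ∀ t ∈ Ioc 0 L.Cstar, |w t| ≤ M) (β' : ℝ) :
    IntegrableOn (fun s => w s * L.surv β j a s * L.hazard β' j a s) (Ioc 0 L.Cstar) := by
  have h1 : IntegrableOn (fun s => (w s * L.survExt β j a s) * L.hazard β' j a s)
      (Ioc 0 L.Cstar) := by
    refine (L.integrableOn_hazard β' j a).bdd_mul (c := M)
      (hw.mul (L.measurable_survExt β j a)).aestronglyMeasurable ?_
    refine (ae_restrict_mem measurableSet_Ioc).mono fun s hs => ?_
    rw [Real.norm_eq_abs, abs_mul, L.survExt_eq β j a (Ioc_subset_Icc_self hs),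
      abs_of_pos (L.surv_pos β j a s)]
    calc |w s| * L.surv β j a s ≤ |w s| * 1 := by
          gcongr; exact L.surv_le_one β j a (Ioc_subset_Icc_self hs)
      _ ≤ M := by rw [mul_one]; exact hM s hs
  refine h1.congr_fun (fun s hs => ?_) measurableSet_Ioc
  simp only [L.survExt_eq β j a (Ioc_subset_Icc_self hs)]

theorem integrableOn_dens : IntegrableOn (L.dens β j a) (Ioc 0 L.Cstar) := by
  refine (L.integrableOn_mul_surv_mul_hazard β j a (w := fun _ => 1) measurable_const (M := 1)
    (fun _ _ => by simp) β).congr_fun (fun s _ => ?_) measurableSet_Ioc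
  simp only [dens]
  ring

theorem integral_dens {s t : ℝ} (hs : 0 ≤ s) (hst : s ≤ t) (ht : t ≤ L.Cstar) :
    ∫ u in Ioc s t, L.dens β j a u = L.surv β j a s - L.surv β j a t := by
  have hint : ∀ {x y}, 0 ≤ x → x ≤ y → y ≤ L.Cstar →
      IntervalIntegrable (L.hazard β j a) volume x y := fun hx hxy hy =>
    (intervalIntegrable_iff_integrableOn_Ioc_of_le hxy).2
      ((L.integrableOn_hazard β j a).mono_set (Ioc_subset_Ioc hx hy))
  have hsplit : ∀ u ∈ Icc s t, L.surv β j a u =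
      L.surv β j a s * Real.exp (-∫ v in s..u, L.hazard β j a v) := by
    intro u hu
    have h0 := intervalIntegral.integral_add_adjacent_intervals
      (hint le_rfl hs (hst.trans ht)) (hint hs hu.1 (hu.2.trans ht))
    rw [surv, surv, ← intervalIntegral.integral_of_le hs,
      ← intervalIntegral.integral_of_le (hs.trans hu.1), ← h0, neg_add, Real.exp_add]
  have h := integral_deriv_comp_primitive (g := fun x : ℝ => Real.exp (-x)) (by fun_prop)
    (hint hs hst ht)
  have hd : ∀ x : ℝ, deriv (fun x : ℝ => Real.exp (-x)) x = -Real.exp (-x) := fun x => by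
    simpa using ((hasDerivAt_neg x).exp).deriv
  simp only [hd, neg_zero, Real.exp_zero, neg_mul, intervalIntegral.integral_neg] at h
  rw [hsplit t ⟨hst, le_rfl⟩]
  have h2 : ∫ u in Ioc s t, L.dens β j a u =
      L.surv β j a s * ∫ u in s..t, Real.exp (-∫ v in s..u, L.hazard β j a v) *
        L.hazard β j a u := by
    rw [intervalIntegral.integral_of_le hst, ← integral_const_mul]
    refine setIntegral_congr_fun measurableSet_Ioc fun u hu => ?_
    simp only [dens, hsplit u (Ioc_subset_Icc_self hu)]
    ring
  rw [h2]
  linear_combination -L.surv β j a s * h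

end StudyLaw

theorem measurableSet_allocation {J m : ℕ} (j : Fin J) (a : Bool) :
    MeasurableSet {w : (Fin J → Bool) × (Fin J → Fin m → ℝ) | w.1 j = a} :=
  measurableSet_eq_fun (by fun_prop) measurable_const

namespace IsTrialData

variable {Ω : Type*} [MeasurableSpace Ω] {P : Measure Ω}
  {J n m : ℕ} {L : StudyLaw J} {βc : ℝ} {Z : Fin n → Fin J → Ω → Bool}
  {T C : Fin n → Fin J → Fin m → Ω → ℝ}

theorem measurableSet_treatment (h : IsTrialData L βc P Z T C) (i : Fin n) (j : Fin J)
    (a : Bool) : MeasurableSet {ω | Z i j ω = a} :=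
  h.measurable_Z i j (measurableSet_singleton a)

theorem measurableSet_treatment₂ (h : IsTrialData L βc P Z T C) (i : Fin n) (j l : Fin J)
    (a b : Bool) : MeasurableSet {ω | Z i j ω = a ∧ Z i l ω = b} :=
  (h.measurableSet_treatment i j a).inter (h.measurableSet_treatment i l b)

theorem measurable_cens (h : IsTrialData L βc P Z T C) (i : Fin n) :
    Measurable fun ω j k => C i j k ω :=
  measurable_pi_lambda _ fun j => measurable_pi_lambda _ fun k => h.measurable_C i j k

theorem measurable_treatment_event (h : IsTrialData L βc P Z T C) (i : Fin n) :
    Measurable fun ω => ((fun j => Z i j ω), fun j k => T i j k ω) :=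
  (measurable_pi_lambda _ fun j => h.measurable_Z i j).prodMk
    (measurable_pi_lambda _ fun j => measurable_pi_lambda _ fun k => h.measurable_T i j k)

variable [IsProbabilityMeasure P]

theorem measureReal_allocation (h : IsTrialData L βc P Z T C) (i : Fin n)
    (Q : (Fin J → Bool) → Prop) [DecidablePred Q] :
    P.real {ω | Q fun j => Z i j ω} = ∑ z, if Q z then (L.alloc z).toReal else 0 := by
  have h1 : {ω | Q fun j => Z i j ω} =
      ⋃ z ∈ Finset.univ.filter Q, {ω | ∀ j, Z i j ω = z j} := by
    ext ω
    simp only [mem_ofPred_eq, Finset.mem_filter, Finset.mem_univ, true_and, mem_iUnion,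
      exists_prop]
    refine ⟨fun hq => ⟨_, hq, fun _ => rfl⟩, fun ⟨z, hz, he⟩ => ?_⟩
    rwa [show (fun j => Z i j ω) = z from funext he]
  rw [h1, measureReal_biUnion_finset]
  · simp_rw [h.law_Z]
    rw [Finset.sum_filter]
  · intro z _ z' _ hne
    refine Set.disjoint_left.2 fun ω h1 h2 => hne (funext fun j => ?_)
    exact (h1 j).symm.trans (h2 j)
  · intro z _
    rw [ofPred_forall]
    exact MeasurableSet.iInter fun j => h.measurable_Z i j (measurableSet_singleton _)

theorem measureReal_treatment (h : IsTrialData L βc P Z T C) (i : Fin n) (j : Fin J) (a : Bool) :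
    P.real {ω | Z i j ω = a} = L.prob j a :=
  h.measureReal_allocation i fun z => z j = a

theorem measureReal_treatment₂ (h : IsTrialData L βc P Z T C) (i : Fin n) (j l : Fin J)
    (a b : Bool) : P.real {ω | Z i j ω = a ∧ Z i l ω = b} = L.prob₂ j l a b :=
  h.measureReal_allocation i fun z => z j = a ∧ z l = b

variable {i : Fin n} {j l : Fin J} {k d : Fin m}

/-- A positive joint treatment probability forces the conditional pair density to be integrable:
it has total mass `1`. -/
theorem integrable_pairDens (h : IsTrialData L βc P Z T C) (hne : (j, k) ≠ (l, d)) (i : Fin n)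
    {a b : Bool} (hab : L.prob₂ j l a b ≠ 0) :
    Integrable (Function.uncurry (L.pairDens j l a b)) := by
  by_contra hni
  have h1 := h.law_T₂ i j k l d hne a b univ MeasurableSet.univ
  simp only [mem_univ, true_and, setIntegral_univ] at h1
  rw [h.measureReal_treatment₂] at h1
  rw [show (∫ x : ℝ × ℝ, L.pairDens j l a b x.1 x.2) = 0 from integral_undef hni, mul_zero] at h1
  exact hab h1

/-- On an event with given treatments, two individuals of a cluster form a censored pair: the
censoring times are decoupled first, and the pair density is inserted next. -/
theorem isCensoredPair (h : IsTrialData L βc P Z T C) (hne : (j, k) ≠ (l, d)) (i : Fin n)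
    {a b : Bool} (hab : L.prob₂ j l a b ≠ 0) :
    IsCensoredPair P {ω | Z i j ω = a ∧ Z i l ω = b} (T i j k) (T i l d) (C i j k) (C i l d)
      (L.prob₂ j l a b) (L.pairDens j l a b) where
  measurable_X := h.measurable_T i j k
  measurable_X' := h.measurable_T i l d
  measurable_Y := h.measurable_C i j k
  measurable_Y' := h.measurable_C i l d
  measurable_dens := L.pairDens_measurable j l a b
  nonneg_dens := L.pairDens_nonneg j l a b
  integrable_dens := h.integrable_pairDens hne i hab
  law := by
    intro H σ τ M hH hM hσ hτ
    have hp : Integrable fun x : ℝ × ℝ => L.pairDens j l a b x.1 x.2 :=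
      h.integrable_pairDens hne i hab
    have hS : MeasurableSet {w : (Fin J → Bool) × (Fin J → Fin m → ℝ) |
        w.1 j = a ∧ w.1 l = b} :=
      (measurableSet_allocation j a).inter (measurableSet_allocation l b)
    have hT : Measurable fun w : (Fin J → Bool) × (Fin J → Fin m → ℝ) => (w.2 j k, w.2 l d) := by
      fun_prop
    have hA : MeasurableSet {x : (Fin J → Fin m → ℝ) × ((Fin J → Bool) × (Fin J → Fin m → ℝ)) |
        σ (x.2.2 j k, x.2.2 l d) ≤ x.1 j k ∧ τ (x.2.2 j k, x.2.2 l d) ≤ x.1 l d} :=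
      (measurableSet_le (hσ.comp (hT.comp measurable_snd)) (by fun_prop)).inter
        (measurableSet_le (hτ.comp (hT.comp measurable_snd)) (by fun_prop))
    have key := (h.indep_cens i).setIntegral_mul_indicator (h.measurable_cens i)
      (h.measurable_treatment_event i) hS (hH.comp hT) (fun x => hM _) hA
    simp only [Function.comp, indicator, mem_ofPred_eq, Pi.one_apply, preimage_ofPred_eq] at key
    rw [key]
    have hmeas : Measurable fun ω => (T i j k ω, T i l d ω) :=
      (h.measurable_T i j k).prodMk (h.measurable_T i l d)
    have hG : Measurable fun x : ℝ × ℝ =>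
        H x * jointSurvival P (C i j k) (C i l d) (σ x) (τ x) :=
      hH.mul ((measurable_survival₂ (h.measurable_C i j k) (h.measurable_C i l d)).comp
        (hσ.prodMk hτ))
    have hmap : (P.restrict {ω | Z i j ω = a ∧ Z i l ω = b}).map
        (fun ω => (T i j k ω, T i l d ω)) = (volume : Measure (ℝ × ℝ)).withDensity
          fun x => ENNReal.ofReal (L.prob₂ j l a b * L.pairDens j l a b x.1 x.2) := by
      ext B hB
      rw [Measure.map_apply hmeas hB, Measure.restrict_apply (hmeas hB), withDensity_apply _ hB,
        ← ofReal_integral_eq_lintegral_ofReal (hp.integrableOn.const_mul _)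
          (ae_of_all _ fun x => mul_nonneg (L.prob₂_nonneg j l a b) (L.pairDens_nonneg _ _ _ _ _ _)),
        integral_const_mul, ← h.law_T₂ i j k l d hne a b B hB, ofReal_measureReal]
      rfl
    have := setIntegral_comp_eq_of_density hmeas
      ((L.pairDens_measurable j l a b).const_mul _).aemeasurable
      (ae_of_all _ fun x => mul_nonneg (L.prob₂_nonneg j l a b) (L.pairDens_nonneg _ _ _ _ _ _))
      hmap hG
    refine Eq.trans this ?_
    rw [← integral_const_mul]
    refine integral_congr_ae (ae_of_all _ fun x => ?_)
    simp only [Function.uncurry]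
    ring

/-- An event time has no atoms: together with an event time of another period it has a joint
density. This matters at `C*`, where the survival function on `[0, C*]` says nothing. -/
theorem measure_event_eq_zero (h : IsTrialData L βc P Z T C) (hJ : 2 ≤ J) (i : Fin n) (j : Fin J)
    (k : Fin m) (x : ℝ) : P {ω | T i j k ω = x} = 0 := by
  have : Nontrivial (Fin J) := Fin.nontrivial_iff_two_le.2 hJ
  obtain ⟨l, hl⟩ := exists_ne j
  have hne : (j, k) ≠ (l, k) := fun he => hl (congrArg Prod.fst he).symm
  have h0 : ∀ a b : Bool, P {ω | T i j k ω = x ∧ Z i j ω = a ∧ Z i l ω = b} = 0 := by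
    intro a b
    have h1 := h.law_T₂ i j k l k hne a b ({x} ×ˢ univ)
      ((measurableSet_singleton x).prod MeasurableSet.univ)
    have h2 : (volume : Measure (ℝ × ℝ)) ({x} ×ˢ univ) = 0 := by
      rw [Measure.volume_eq_prod, Measure.prod_prod]
      simp
    rw [setIntegral_measure_zero _ h2, mul_zero, measureReal_eq_zero_iff] at h1
    simpa using h1
  refine measure_mono_null (t := ⋃ a : Bool, ⋃ b : Bool,
    {ω | T i j k ω = x ∧ Z i j ω = a ∧ Z i l ω = b}) (fun ω hω => ?_)
    (measure_iUnion_null fun a => measure_iUnion_null fun b => h0 a b)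
  simp only [mem_iUnion]
  exact ⟨_, _, hω, rfl, rfl⟩

/-- On `(0, C*]` the event time has, jointly with `Z_{ij} = a`, the density
`P(Z_{ij} = a) f_j(t | a)`. -/
theorem map_event_eq_withDensity (h : IsTrialData L βc P Z T C) (hJ : 2 ≤ J) (i : Fin n)
    (j : Fin J) (k : Fin m) (a : Bool) :
    (P.restrict ({ω | Z i j ω = a} ∩ T i j k ⁻¹' Ioc 0 L.Cstar)).map (T i j k) =
      (volume.restrict (Ioc 0 L.Cstar)).withDensity
        fun t => ENNReal.ofReal (L.prob j a * L.dens βc j a t) := by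
  have hT := h.measurable_T i j k
  refine Measure.ext_of_Ici _ _ fun s => ?_
  have hint : IntegrableOn (fun t => L.prob j a * L.dens βc j a t) (Ioc 0 L.Cstar) :=
    (L.integrableOn_dens βc j a).const_mul _
  rw [Measure.map_apply hT measurableSet_Ici, Measure.restrict_apply (hT measurableSet_Ici),
    withDensity_apply _ measurableSet_Ici, Measure.restrict_restrict measurableSet_Ici,
    ← ofReal_integral_eq_lintegral_ofReal (hint.mono_set inter_subset_right)
      ((ae_restrict_mem (measurableSet_Ici.inter measurableSet_Ioc)).mono fun t ht =>
        mul_nonneg (L.prob_nonneg j a) (L.dens_nonneg βc j a ht.2)), integral_const_mul]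
  rw [← ofReal_measureReal]
  congr 1
  rcases le_or_gt s L.Cstar with hs | hs
  · have hs' : max s 0 ∈ Icc 0 L.Cstar := ⟨le_max_right _ _, max_le hs L.Cstar_pos.le⟩
    have hc : L.Cstar ∈ Icc 0 L.Cstar := ⟨L.Cstar_pos.le, le_rfl⟩
    -- up to the null events `T = 0` and `T = C*` the left-hand event is `max s 0 ≤ T < C*`
    have e1 : (T i j k ⁻¹' Ici s ∩ ({ω | Z i j ω = a} ∩ T i j k ⁻¹' Ioc 0 L.Cstar) : Set Ω)
        =ᵐ[P] ({ω | max s 0 ≤ T i j k ω ∧ Z i j ω = a} \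
          {ω | L.Cstar ≤ T i j k ω ∧ Z i j ω = a} : Set Ω) := by
      have n0 : ∀ᵐ ω ∂P, T i j k ω ≠ 0 := by
        simpa [ae_iff] using h.measure_event_eq_zero hJ i j k 0
      have n1 : ∀ᵐ ω ∂P, T i j k ω ≠ L.Cstar := by
        simpa [ae_iff] using h.measure_event_eq_zero hJ i j k L.Cstar
      filter_upwards [n0, n1] with ω h0 h1
      apply propext
      change (s ≤ T i j k ω ∧ (Z i j ω = a ∧ 0 < T i j k ω ∧ T i j k ω ≤ L.Cstar)) ↔
        ((max s 0 ≤ T i j k ω ∧ Z i j ω = a) ∧ ¬ (L.Cstar ≤ T i j k ω ∧ Z i j ω = a))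
      rw [max_le_iff]
      constructor
      · rintro ⟨p1, p2, p3, p4⟩
        exact ⟨⟨⟨p1, p3.le⟩, p2⟩, fun q => h1 (le_antisymm p4 q.1)⟩
      · rintro ⟨⟨⟨p1, p3⟩, p2⟩, q⟩
        exact ⟨p1, p2, lt_of_le_of_ne p3 (Ne.symm h0),
          le_of_not_ge fun r => q ⟨r, p2⟩⟩
    have e2 : (Ici s ∩ Ioc 0 L.Cstar : Set ℝ) =ᵐ[volume] (Ioc (max s 0) L.Cstar : Set ℝ) := by
      filter_upwards [Measure.ae_ne volume s] with t ht
      apply propext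
      change (s ≤ t ∧ (0 < t ∧ t ≤ L.Cstar)) ↔ (max s 0 < t ∧ t ≤ L.Cstar)
      rw [max_lt_iff]
      exact ⟨fun q => ⟨⟨lt_of_le_of_ne q.1 (Ne.symm ht), q.2.1⟩, q.2.2⟩,
        fun q => ⟨q.1.1.le, q.1.2, q.2⟩⟩
    have hsub : {ω | L.Cstar ≤ T i j k ω ∧ Z i j ω = a} ⊆
        {ω | max s 0 ≤ T i j k ω ∧ Z i j ω = a} := fun ω hω => ⟨hs'.2.trans hω.1, hω.2⟩
    have hmc : MeasurableSet {ω | L.Cstar ≤ T i j k ω ∧ Z i j ω = a} :=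
      (hT measurableSet_Ici).inter (h.measurableSet_treatment i j a)
    rw [measureReal_congr e1, setIntegral_congr_set e2, measureReal_sdiff hsub hmc,
      h.law_T i j k a _ hs', h.law_T i j k a _ hc,
      L.integral_dens βc j a hs'.1 hs'.2 le_rfl]
    ring
  · have e1 : T i j k ⁻¹' Ici s ∩ ({ω | Z i j ω = a} ∩ T i j k ⁻¹' Ioc 0 L.Cstar) = ∅ := by
      ext ω
      simp only [mem_inter_iff, mem_preimage, mem_Ici, mem_Ioc, mem_empty_iff_false, iff_false]
      rintro ⟨h1, -, -, h2⟩
      linarith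
    have e2 : Ici s ∩ Ioc 0 L.Cstar = ∅ := by
      ext t
      simp only [mem_inter_iff, mem_Ici, mem_Ioc, mem_empty_iff_false, iff_false]
      rintro ⟨h1, -, h2⟩
      linarith
    simp [e1, e2]

theorem isCensoredTime (h : IsTrialData L βc P Z T C) (hJ : 2 ≤ J) (i : Fin n) (j : Fin J)
    (k : Fin m) (a : Bool) :
    IsCensoredTime P L.Cstar {ω | Z i j ω = a} (T i j k) (C i j k) (L.prob j a)
      (L.surv βc j a) (L.dens βc j a) where
  measurable_X := h.measurable_T i j k
  measurable_Y := h.measurable_C i j k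
  law_observed := by
    intro α M hα hM
    have hT := h.measurable_T i j k
    have hS : MeasurableSet {w : (Fin J → Bool) × (Fin J → Fin m → ℝ) | w.1 j = a} :=
      measurableSet_allocation j a
    have hA : MeasurableSet {x : (Fin J → Fin m → ℝ) × ((Fin J → Bool) × (Fin J → Fin m → ℝ)) |
        x.2.2 j k ≤ x.1 j k} := measurableSet_le (by fun_prop) (by fun_prop)
    have hproj : Measurable fun w : (Fin J → Bool) × (Fin J → Fin m → ℝ) => w.2 j k := by
      fun_prop
    have hα' : Measurable ((Ioc 0 L.Cstar).indicator α) := hα.indicator measurableSet_Ioc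
    have key := (h.indep_cens i).setIntegral_mul_indicator (h.measurable_cens i)
      (h.measurable_treatment_event i) hS (hα'.comp hproj) (M := M)
      (fun x => by
        rw [← Real.norm_eq_abs]
        exact (norm_indicator_le_norm_self _ _).trans (hM _)) hA
    have e1 : ∫ ω in {ω | Z i j ω = a}, jumpPart L.Cstar α (T i j k ω) (C i j k ω) ∂P =
        ∫ ω in {ω | Z i j ω = a}, (Ioc 0 L.Cstar).indicator
          (fun t => α t * P.real {ω | t ≤ C i j k ω}) (T i j k ω) ∂P := by
      refine Eq.trans ?_ (key.trans ?_)
      · congr 1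
        funext ω
        by_cases h1 : T i j k ω ∈ Ioc 0 L.Cstar <;> by_cases h2 : T i j k ω ≤ C i j k ω <;>
          simp [jumpPart, h1, h2]
      · congr 1
        funext ω
        by_cases h1 : T i j k ω ∈ Ioc 0 L.Cstar <;> simp [h1]
    have e2 : ∫ ω in {ω | Z i j ω = a}, (Ioc 0 L.Cstar).indicator
          (fun t => α t * P.real {ω | t ≤ C i j k ω}) (T i j k ω) ∂P =
        ∫ ω in {ω | Z i j ω = a} ∩ T i j k ⁻¹' Ioc 0 L.Cstar,
          α (T i j k ω) * P.real {ω' | T i j k ω ≤ C i j k ω'} ∂P := by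
      rw [← setIntegral_indicator (hT measurableSet_Ioc)]
      rfl
    rw [e1, e2, setIntegral_comp_eq_of_density hT
      ((L.integrableOn_dens βc j a).aemeasurable.const_mul _)
      ((ae_restrict_mem measurableSet_Ioc).mono fun t ht =>
        mul_nonneg (L.prob_nonneg j a) (L.dens_nonneg βc j a ht))
      (h.map_event_eq_withDensity hJ i j k a)
      (H := fun t => α t * P.real {ω' | t ≤ C i j k ω'})
      (hα.mul (measurable_survival (h.measurable_C i j k))), ← integral_const_mul]
    congr 1
    funext t
    ring
  law_atRisk := by
    intro s hs
    have hproj : Measurable fun w : (Fin J → Bool) × (Fin J → Fin m → ℝ) => w.2 j k := by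
      fun_prop
    have hS : MeasurableSet {w : (Fin J → Bool) × (Fin J → Fin m → ℝ) | s ≤ w.2 j k ∧ w.1 j = a} :=
      (hproj measurableSet_Ici).inter (measurableSet_allocation j a)
    have hA : MeasurableSet {x : (Fin J → Fin m → ℝ) × ((Fin J → Bool) × (Fin J → Fin m → ℝ)) |
        s ≤ x.1 j k} := measurableSet_le measurable_const (by fun_prop)
    have key := (h.indep_cens i).setIntegral_mul_indicator (h.measurable_cens i)
      (h.measurable_treatment_event i) hS (H := fun _ => 1) measurable_const (M := 1)
      (fun x => by simp) hA
    have hm : MeasurableSet {ω | s ≤ T i j k ω} := h.measurable_T i j k measurableSet_Ici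
    have e1 : ∫ ω in {ω | Z i j ω = a}, atRisk (T i j k ω) (C i j k ω) s ∂P =
        ∫ ω in {ω | s ≤ T i j k ω ∧ Z i j ω = a}, (if s ≤ C i j k ω then 1 else 0) ∂P := by
      rw [show {ω | s ≤ T i j k ω ∧ Z i j ω = a} = {ω | Z i j ω = a} ∩ {ω | s ≤ T i j k ω} from
        inter_comm _ _, ← setIntegral_indicator hm]
      congr 1
      funext ω
      by_cases h1 : s ≤ T i j k ω <;> by_cases h2 : s ≤ C i j k ω <;> simp [atRisk, h1, h2]
    rw [e1]
    simp only [one_mul, indicator, mem_ofPred_eq, Pi.one_apply, preimage_ofPred_eq] at key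
    rw [key, setIntegral_const, h.law_T i j k a s (Ioc_subset_Icc_self hs), smul_eq_mul]
    ring

end IsTrialData

/-! ### Moments of the individual scores -/

theorem abs_trt_sub_le (a : Bool) {x : ℝ} (hx : x ∈ Icc (0 : ℝ) 1) : |trt a - x| ≤ 1 := by
  have h0 := hx.1
  have h1 := hx.2
  cases a <;> simp only [trt, abs_le] <;> constructor <;> norm_num <;> linarith

theorem setIntegral_sub_sub_add {Ω : Type*} [MeasurableSpace Ω] {P : Measure Ω}
    {f₁ f₂ f₃ f₄ : Ω → ℝ} (h₁ : Integrable f₁ P) (h₂ : Integrable f₂ P) (h₃ : Integrable f₃ P)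
    (h₄ : Integrable f₄ P) {S : Set Ω} :
    ∫ ω in S, (f₁ ω - f₂ ω - f₃ ω + f₄ ω) ∂P =
      (∫ ω in S, f₁ ω ∂P) - (∫ ω in S, f₂ ω ∂P) - (∫ ω in S, f₃ ω ∂P) + ∫ ω in S, f₄ ω ∂P := by
  have h₁₂ : Integrable (fun ω => f₁ ω - f₂ ω) P := h₁.sub h₂
  have h₁₃ : Integrable (fun ω => f₁ ω - f₂ ω - f₃ ω) P := h₁₂.sub h₃
  rw [integral_add h₁₃.integrableOn h₄.integrableOn, integral_sub h₁₂.integrableOn h₃.integrableOn,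
    integral_sub h₁.integrableOn h₂.integrableOn]

/-- The rate `{a - μ_j(t)} λ_{0j}(t) exp(β₀ a)` at which the model compensator of an individual
score grows. -/
def StudyLaw.scoreRate {J : ℕ} (L : StudyLaw J) (βc β₀ : ℝ) (j : Fin J) (a : Bool) (t : ℝ) : ℝ :=
  (trt a - L.mu βc β₀ j t) * L.hazard β₀ j a t

theorem StudyLaw.integrableOn_scoreRate {J : ℕ} (L : StudyLaw J) {βc β₀ : ℝ} {j : Fin J}
    {ν : ℝ → ℝ} (hν : Measurable ν) (hν01 : ∀ t, ν t ∈ Icc (0 : ℝ) 1)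
    (hμ : EqOn ν (L.mu βc β₀ j) (Ioc 0 L.Cstar)) (a : Bool) :
    IntegrableOn (L.scoreRate βc β₀ j a) (Ioc 0 L.Cstar) := by
  have h1 : IntegrableOn (fun t => (trt a - ν t) * L.hazard β₀ j a t) (Ioc 0 L.Cstar) :=
    (L.integrableOn_hazard β₀ j a).bdd_mul (c := 1) (measurable_const.sub hν).aestronglyMeasurable
      (ae_of_all _ fun t => abs_trt_sub_le a (hν01 t))
  refine h1.congr_fun (fun t ht => ?_) measurableSet_Ioc
  simp only [StudyLaw.scoreRate, hμ ht]

namespace IsTrialData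

variable {Ω : Type*} [MeasurableSpace Ω] {P : Measure Ω} [IsProbabilityMeasure P]
  {J n m : ℕ} {L : StudyLaw J} {βc : ℝ} {Z : Fin n → Fin J → Ω → Bool}
  {T C : Fin n → Fin J → Fin m → Ω → ℝ} {β₀ : ℝ} {j l : Fin J} {ν ν' : ℝ → ℝ}

/-- The expectation `s_j^{(r)}` depends only on the study law. -/
theorem expS_eq (h : IsTrialData L βc P Z T C) (hJ : 2 ≤ J) (β₀ : ℝ) (r : ℕ) (i : Fin n)
    (j : Fin J) {t : ℝ} (ht : t ∈ Ioc 0 L.Cstar) :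
    expS P Z T C β₀ r i j t = m * L.limS βc β₀ r j t := by
  have hk : ∀ k, Integrable (fun ω => atRisk (T i j k ω) (C i j k ω) t * trt (Z i j ω) ^ r *
      Real.exp (β₀ * trt (Z i j ω))) P ∧
      ∫ ω, atRisk (T i j k ω) (C i j k ω) t * trt (Z i j ω) ^ r *
        Real.exp (β₀ * trt (Z i j ω)) ∂P = L.limS βc β₀ r j t := by
    intro k
    have hint : Integrable (fun ω => atRisk (T i j k ω) (C i j k ω) t * trt (Z i j ω) ^ r *
        Real.exp (β₀ * trt (Z i j ω))) P := by
      have h1 : Measurable fun ω => atRisk (T i j k ω) (C i j k ω) t :=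
        measurable_atRisk.comp
          (((h.measurable_T i j k).prodMk (h.measurable_C i j k)).prodMk measurable_const)
      have h2 : Measurable fun ω => trt (Z i j ω) ^ r * Real.exp (β₀ * trt (Z i j ω)) :=
        (measurable_of_finite fun a : Bool => trt a ^ r * Real.exp (β₀ * trt a)).comp
          (h.measurable_Z i j)
      simp_rw [mul_assoc]
      refine Integrable.of_bound (h1.mul h2).aestronglyMeasurable
        (∑ a : Bool, |trt a ^ r * Real.exp (β₀ * trt a)|) (ae_of_all _ fun ω => ?_)
      rw [Real.norm_eq_abs, abs_mul]
      refine (mul_le_of_le_one_left (abs_nonneg _) (abs_atRisk_le _ _ _)).trans ?_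
      exact Finset.single_le_sum (f := fun a : Bool => |trt a ^ r * Real.exp (β₀ * trt a)|)
        (fun _ _ => abs_nonneg _) (Finset.mem_univ (Z i j ω))
    refine ⟨hint, ?_⟩
    rw [integral_eq_sum_setIntegral_fiber (h.measurable_Z i j) hint, StudyLaw.limS,
      Finset.mul_sum]
    refine Finset.sum_congr rfl fun a _ => ?_
    have e1 : ∫ ω in {ω | Z i j ω = a}, atRisk (T i j k ω) (C i j k ω) t * trt (Z i j ω) ^ r *
        Real.exp (β₀ * trt (Z i j ω)) ∂P =
        ∫ ω in {ω | Z i j ω = a}, atRisk (T i j k ω) (C i j k ω) t *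
          (trt a ^ r * Real.exp (β₀ * trt a)) ∂P := by
      refine setIntegral_congr_fun (h.measurableSet_treatment i j a) fun ω hω => ?_
      simp only [show Z i j ω = a from hω, mul_assoc]
    rw [e1, integral_mul_const, (h.isCensoredTime hJ i j k a).law_atRisk t ht, h.law_C i j k t ht]
    ring
  rw [expS, integral_finsetSum _ fun k _ => (hk k).1]
  simp [fun k => (hk k).2]

/-- A measurable version of `μ_j` on `(0, C*]` with values in `[0, 1]`. -/
theorem exists_measurable_mu (h : IsTrialData L βc P Z T C) (i : Fin n) (k : Fin m)
    (β₀ : ℝ) (j : Fin J) :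
    ∃ ν : ℝ → ℝ, Measurable ν ∧ (∀ t, ν t ∈ Icc (0 : ℝ) 1) ∧
      EqOn ν (L.mu βc β₀ j) (Ioc 0 L.Cstar) := by
  have hS : ∀ r, Measurable ((Ioc 0 L.Cstar).indicator (L.limS βc β₀ r j)) := by
    intro r
    have e : (Ioc 0 L.Cstar).indicator (L.limS βc β₀ r j) =
        (Ioc 0 L.Cstar).indicator fun t => P.real {ω | t ≤ C i j k ω} *
          ∑ a : Bool, L.prob j a * L.survExt βc j a t * trt a ^ r * Real.exp (β₀ * trt a) := by
      refine indicator_congr fun t ht => ?_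
      simp only [StudyLaw.limS, h.law_C i j k t ht, L.survExt_eq βc j _ (Ioc_subset_Icc_self ht)]
    rw [e]
    refine Measurable.indicator ?_ measurableSet_Ioc
    refine (measurable_survival (h.measurable_C i j k)).mul
      (Finset.measurable_sum _ fun a _ => ?_)
    exact (((L.measurable_survExt βc j a).const_mul _).mul_const _).mul_const _
  refine ⟨fun t => (Ioc 0 L.Cstar).indicator (L.limS βc β₀ 1 j) t /
    (Ioc 0 L.Cstar).indicator (L.limS βc β₀ 0 j) t, (hS 1).div (hS 0), fun t => ?_,
    fun t ht => ?_⟩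
  · by_cases ht : t ∈ Ioc 0 L.Cstar
    · simp only [indicator_of_mem ht]
      have hG : 0 ≤ L.censSurv j t := by
        rw [← h.law_C i j k t ht]; exact measureReal_nonneg
      have ha : ∀ a, 0 ≤ L.prob j a * L.surv βc j a t := fun a =>
        mul_nonneg (L.prob_nonneg j a) (L.surv_pos βc j a t).le
      have h1 := mul_nonneg (ha true) (Real.exp_pos β₀).le
      have h2 := ha false
      have e1 : L.limS βc β₀ 1 j t =
          L.censSurv j t * (L.prob j true * L.surv βc j true t * Real.exp β₀) := by
        simp [StudyLaw.limS, trt]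
      have e0 : L.limS βc β₀ 0 j t = L.censSurv j t *
          (L.prob j true * L.surv βc j true t * Real.exp β₀ +
            L.prob j false * L.surv βc j false t) := by
        simp [StudyLaw.limS, trt]
      rw [e1, e0]
      have h3 := mul_nonneg hG (add_nonneg h1 h2)
      exact ⟨div_nonneg (mul_nonneg hG h1) h3, div_le_one_of_le₀
        (mul_le_mul_of_nonneg_left (le_add_of_nonneg_right h2) hG) h3⟩
    · simp [indicator_of_notMem ht]
  · simp only [indicator_of_mem ht, StudyLaw.mu]

theorem indivScore_eq (h : IsTrialData L βc P Z T C) (hJ : 2 ≤ J)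
    (hμ : EqOn ν (L.mu βc β₀ j) (Ioc 0 L.Cstar)) (i : Fin n) (k : Fin m) (ω : Ω) :
    indivScore L P Z T C β₀ i j k ω =
      jumpPart L.Cstar (fun t => trt (Z i j ω) - ν t) (T i j k ω) (C i j k ω) -
        compPart L.Cstar (L.scoreRate βc β₀ j (Z i j ω)) (T i j k ω) (C i j k ω) := by
  have hm : (m : ℝ) ≠ 0 := Nat.cast_ne_zero.2 (Fin.pos k).ne'
  have hr : ∀ t ∈ Ioc 0 L.Cstar, expS P Z T C β₀ 1 i j t / expS P Z T C β₀ 0 i j t =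
      L.mu βc β₀ j t := fun t ht => by
    rw [h.expS_eq hJ β₀ 1 i j ht, h.expS_eq hJ β₀ 0 i j ht, mul_div_mul_left _ _ hm, StudyLaw.mu]
  classical
  rw [indivScore, setIntegral_dirac]
  congr 1
  · by_cases h1 : T i j k ω ∈ Ioc 0 L.Cstar
    · by_cases h2 : T i j k ω ≤ C i j k ω <;>
        simp [jumpPart, atRisk, h1, h2, hr _ h1, hμ h1]
    · simp [jumpPart, h1]
  · refine setIntegral_congr_fun measurableSet_Ioc fun t ht => ?_
    simp only [hr t ht, StudyLaw.scoreRate]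
    ring

/-- The score is a bounded measurable function of treatment, event time and censoring time. -/
theorem exists_measurable_score (h : IsTrialData L βc P Z T C) (hJ : 2 ≤ J) (i : Fin n) (k : Fin m)
    (β₀ : ℝ) (j : Fin J) :
    ∃ g : Bool × ℝ × ℝ → ℝ, Measurable g ∧ (∃ M, ∀ x, |g x| ≤ M) ∧ ∀ i k ω,
      indivScore L P Z T C β₀ i j k ω = g (Z i j ω, T i j k ω, C i j k ω) := by
  obtain ⟨ν, hν, hν01, hμ⟩ := h.exists_measurable_mu i k β₀ j
  have hφ := L.integrableOn_scoreRate hν hν01 hμ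
  refine ⟨fun x => jumpPart L.Cstar (fun t => trt x.1 - ν t) x.2.1 x.2.2 -
    compPart L.Cstar (L.scoreRate βc β₀ j x.1) x.2.1 x.2.2, ?_, ?_,
    fun i k ω => h.indivScore_eq hJ hμ i k ω⟩
  · refine measurable_from_prod_countable_right fun a => ?_
    have hα : Measurable fun t => trt a - ν t := measurable_const.sub hν
    exact (measurable_jumpPart hα).sub (measurable_compPart (hφ a))
  · refine ⟨1 + ∑ a : Bool, ∫ u in Ioc 0 L.Cstar, |L.scoreRate βc β₀ j a u|, fun x => ?_⟩
    refine (abs_sub _ _).trans (add_le_add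
      (abs_jumpPart_le (fun t _ => abs_trt_sub_le _ (hν01 t)) zero_le_one _ _) ?_)
    refine (abs_compPart_le (hφ x.1) _ _).trans ?_
    exact Finset.single_le_sum
      (f := fun a : Bool => ∫ u in Ioc 0 L.Cstar, |L.scoreRate βc β₀ j a u|)
      (fun a _ => integral_nonneg fun u => abs_nonneg _) (Finset.mem_univ x.1)

theorem memLp_indivScore (h : IsTrialData L βc P Z T C) (hJ : 2 ≤ J) (β₀ : ℝ) (i : Fin n)
    (j : Fin J) (k : Fin m) : MemLp (indivScore L P Z T C β₀ i j k) 2 P := by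
  obtain ⟨g, hg, ⟨M, hM⟩, he⟩ := h.exists_measurable_score hJ i k β₀ j
  have e : indivScore L P Z T C β₀ i j k = fun ω => g (Z i j ω, T i j k ω, C i j k ω) :=
    funext fun ω => he i k ω
  rw [e]
  refine MemLp.of_bound (hg.comp ((h.measurable_Z i j).prodMk ((h.measurable_T i j k).prodMk
    (h.measurable_C i j k)))).aestronglyMeasurable M (ae_of_all _ fun ω => hM _)

theorem integrable_jumpPart (h : IsTrialData L βc P Z T C) (i : Fin n) (j : Fin J) (k : Fin m)
    {c M : ℝ} {α : ℝ → ℝ} (hα : Measurable α) (hM : ∀ t, |α t| ≤ M) :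
    Integrable (fun ω => jumpPart c α (T i j k ω) (C i j k ω)) P :=
  Integrable.of_bound ((measurable_jumpPart hα).comp
    ((h.measurable_T i j k).prodMk (h.measurable_C i j k))).aestronglyMeasurable M
    (ae_of_all _ fun _ => abs_jumpPart_le (fun t _ => hM t) ((abs_nonneg _).trans (hM 0)) _ _)

theorem integrable_compPart (h : IsTrialData L βc P Z T C) (i : Fin n) (j : Fin J) (k : Fin m)
    {c : ℝ} {φ : ℝ → ℝ} (hφ : IntegrableOn φ (Ioc 0 c)) :
    Integrable (fun ω => compPart c φ (T i j k ω) (C i j k ω)) P :=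
  Integrable.of_bound ((measurable_compPart hφ).comp
    ((h.measurable_T i j k).prodMk (h.measurable_C i j k))).aestronglyMeasurable _
    (ae_of_all _ fun _ => abs_compPart_le hφ _ _)

/-- Integrability of `G(s) w(s) F(s) λ(s)` over the follow-up interval, with `w` bounded. -/
theorem integrableOn_cens_mul (h : IsTrialData L βc P Z T C) (i : Fin n) (j : Fin J) (k : Fin m)
    {w : ℝ → ℝ} (hw : Measurable w) {M : ℝ} (hM : ∀ t, |w t| ≤ M) (a : Bool) (β' : ℝ) :
    IntegrableOn (fun s => P.real {ω | s ≤ C i j k ω} * w s * L.surv βc j a s * L.hazard β' j a s)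
      (Ioc 0 L.Cstar) := by
  refine L.integrableOn_mul_surv_mul_hazard βc j a
    ((measurable_survival (h.measurable_C i j k)).mul hw) (M := M) (fun t _ => ?_) β'
  rw [Pi.mul_apply, abs_mul, abs_of_nonneg measureReal_nonneg]
  exact (mul_le_of_le_one_left (abs_nonneg _) measureReal_le_one).trans (hM t)

theorem setIntegral_indivScore (h : IsTrialData L βc P Z T C) (hJ : 2 ≤ J) (β₀ : ℝ) (i : Fin n)
    (j : Fin J) (k : Fin m) (a : Bool) :
    ∫ ω in {ω | Z i j ω = a}, indivScore L P Z T C β₀ i j k ω ∂P =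
      L.prob j a * L.condMean βc β₀ j a := by
  obtain ⟨ν, hν, hν01, hμ⟩ := h.exists_measurable_mu i k β₀ j
  have hφ := L.integrableOn_scoreRate hν hν01 hμ a
  have hα : Measurable fun t => trt a - ν t := measurable_const.sub hν
  have hαM : ∀ t, |trt a - ν t| ≤ 1 := fun t => abs_trt_sub_le a (hν01 t)
  have e1 : ∫ ω in {ω | Z i j ω = a}, indivScore L P Z T C β₀ i j k ω ∂P =
      ∫ ω in {ω | Z i j ω = a}, (jumpPart L.Cstar (fun t => trt a - ν t) (T i j k ω) (C i j k ω) -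
        compPart L.Cstar (L.scoreRate βc β₀ j a) (T i j k ω) (C i j k ω)) ∂P := by
    refine setIntegral_congr_fun (h.measurableSet_treatment i j a) fun ω hω => ?_
    simp only [h.indivScore_eq hJ hμ, show Z i j ω = a from hω]
  rw [e1, integral_sub (h.integrable_jumpPart i j k hα hαM).integrableOn
    (h.integrable_compPart i j k hφ).integrableOn,
    (h.isCensoredTime hJ i j k a).law_observed _ 1 hα hαM,
    (h.isCensoredTime hJ i j k a).integral_comp hφ, ← mul_sub]
  have i1 := h.integrableOn_cens_mul i j k hα hαM a βc
  have i2 := h.integrableOn_cens_mul i j k hα hαM a β₀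
  have e2 : ∀ s ∈ Ioc 0 L.Cstar, L.mu βc β₀ j s = ν s := fun s hs => (hμ hs).symm
  congr 1
  rw [StudyLaw.condMean]
  have f1 : ∫ s in Ioc 0 L.Cstar, P.real {ω | s ≤ C i j k ω} * (trt a - ν s) * L.dens βc j a s =
      ∫ s in Ioc 0 L.Cstar, P.real {ω | s ≤ C i j k ω} * (trt a - ν s) * L.surv βc j a s *
        L.hazard βc j a s := by
    refine setIntegral_congr_fun measurableSet_Ioc fun s hs => ?_
    simp only [StudyLaw.dens]; ring
  have f2 : ∫ s in Ioc 0 L.Cstar, P.real {ω | s ≤ C i j k ω} * L.surv βc j a s *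
        L.scoreRate βc β₀ j a s =
      ∫ s in Ioc 0 L.Cstar, P.real {ω | s ≤ C i j k ω} * (trt a - ν s) * L.surv βc j a s *
        L.hazard β₀ j a s := by
    refine setIntegral_congr_fun measurableSet_Ioc fun s hs => ?_
    simp only [StudyLaw.scoreRate, e2 s hs]; ring
  rw [f1, f2, ← integral_sub i1 i2]
  refine setIntegral_congr_fun measurableSet_Ioc fun s hs => ?_
  simp only [e2 s hs, StudyLaw.dens, ← h.law_C i j k s hs]
  ring

/-- The second moment given treatment. The square of the compensator is itself a compensator, so
that it contributes an integral against the at-risk probability `𝒢 ℱ_j`, of the same shape as the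
cross term, which contributes one against the density `𝒢 f_j`. -/
theorem setIntegral_indivScore_sq (h : IsTrialData L βc P Z T C) (hJ : 2 ≤ J) (β₀ : ℝ) (i : Fin n)
    (j : Fin J) (k : Fin m) (a : Bool) :
    ∫ ω in {ω | Z i j ω = a}, indivScore L P Z T C β₀ i j k ω ^ 2 ∂P =
      L.prob j a * (L.q0 βc β₀ j a + L.drift βc β₀ j a) := by
  obtain ⟨ν, hν, hν01, hμ⟩ := h.exists_measurable_mu i k β₀ j
  have hφ := L.integrableOn_scoreRate hν hν01 hμ a
  set φ := L.scoreRate βc β₀ j a with hφdef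
  have hα : Measurable fun t => trt a - ν t := measurable_const.sub hν
  have hαM : ∀ t, |trt a - ν t| ≤ 1 := fun t => abs_trt_sub_le a (hν01 t)
  have e2 : ∀ s ∈ Ioc 0 L.Cstar, L.mu βc β₀ j s = ν s := fun s hs => (hμ hs).symm
  -- a bounded continuous version of the primitive `A` of the rate
  set A : ℝ → ℝ := fun x => ∫ u in (0 : ℝ)..x, (Ioc 0 L.Cstar).indicator φ u with hA
  have hAc : Continuous A := continuous_primitive_indicator hφ
  have hAb : ∀ x, |A x| ≤ ∫ u in Ioc 0 L.Cstar, |φ u| := abs_primitive_indicator_le hφ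
  have hAe : ∀ s ∈ Ioc 0 L.Cstar, ∫ u in Ioc 0 s, φ u = A s := fun s hs =>
    (primitive_indicator_eq (Ioc_subset_Icc_self hs)).symm
  have hα2 : Measurable fun t => (trt a - ν t) * (trt a - ν t) := hα.mul hα
  have hα2M : ∀ t, |(trt a - ν t) * (trt a - ν t)| ≤ 1 := fun t => by
    rw [abs_mul]; exact mul_le_one₀ (hαM t) (abs_nonneg _) (hαM t)
  have hαA : Measurable fun t => (trt a - ν t) * A t := hα.mul hAc.measurable
  have hαAM : ∀ t, |(trt a - ν t) * A t| ≤ ∫ u in Ioc 0 L.Cstar, |φ u| := fun t => by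
    rw [abs_mul]; exact (mul_le_of_le_one_left (abs_nonneg _) (hαM t)).trans (hAb t)
  have hχ : IntegrableOn (fun u => 2 * (∫ v in Ioc 0 u, φ v) * φ u) (Ioc 0 L.Cstar) := by
    have h1 : IntegrableOn (fun u => (2 * A u) * φ u) (Ioc 0 L.Cstar) := by
      refine Integrable.bdd_mul (c := 2 * ∫ u in Ioc 0 L.Cstar, |φ u|) hφ
        (continuous_const.mul hAc).aestronglyMeasurable (ae_of_all _ fun u => ?_)
      rw [Real.norm_eq_abs, abs_mul, abs_two]
      have := hAb u
      linarith
    refine h1.congr_fun (fun s hs => ?_) measurableSet_Ioc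
    simp only [hAe s hs]
  have e1 : ∫ ω in {ω | Z i j ω = a}, indivScore L P Z T C β₀ i j k ω ^ 2 ∂P =
      ∫ ω in {ω | Z i j ω = a},
        (jumpPart L.Cstar (fun t => (trt a - ν t) * (trt a - ν t)) (T i j k ω) (C i j k ω) -
          jumpPart L.Cstar (fun t => (trt a - ν t) * A t) (T i j k ω) (C i j k ω) -
          jumpPart L.Cstar (fun t => (trt a - ν t) * A t) (T i j k ω) (C i j k ω) +
          compPart L.Cstar (fun u => 2 * (∫ v in Ioc 0 u, φ v) * φ u)
            (T i j k ω) (C i j k ω)) ∂P := by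
    refine setIntegral_congr_fun (h.measurableSet_treatment i j a) fun ω hω => ?_
    have hcross : EqOn (fun t => (trt a - ν t) * A t)
        (fun s => (trt a - ν s) * ∫ u in Ioc 0 s, φ u) (Ioc 0 L.Cstar) := fun s hs => by
      simp only [hAe s hs]
    simp only [h.indivScore_eq hJ hμ, show Z i j ω = a from hω, ← hφdef]
    rw [← jumpPart_mul_jumpPart, ← compPart_sq hφ, jumpPart_congr hcross, ← jumpPart_mul_compPart]
    ring
  have j1 := h.integrable_jumpPart i j k (c := L.Cstar) hα2 hα2M
  have j2 := h.integrable_jumpPart i j k (c := L.Cstar) hαA hαAM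
  rw [e1, setIntegral_sub_sub_add j1 j2 j2 (h.integrable_compPart i j k hχ),
    (h.isCensoredTime hJ i j k a).law_observed _ 1 hα2 hα2M,
    (h.isCensoredTime hJ i j k a).law_observed _ _ hαA hαAM,
    (h.isCensoredTime hJ i j k a).integral_comp hχ]
  have i1 := h.integrableOn_cens_mul i j k hαA hαAM a βc
  have i2 := h.integrableOn_cens_mul i j k hαA hαAM a β₀
  have f0 : ∫ s in Ioc 0 L.Cstar, P.real {ω | s ≤ C i j k ω} * ((trt a - ν s) * (trt a - ν s)) *
      L.dens βc j a s = L.q0 βc β₀ j a := by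
    rw [StudyLaw.q0]
    refine setIntegral_congr_fun measurableSet_Ioc fun s hs => ?_
    simp only [e2 s hs, ← h.law_C i j k s hs]
    ring
  have f1 : ∫ s in Ioc 0 L.Cstar, P.real {ω | s ≤ C i j k ω} * ((trt a - ν s) * A s) *
        L.dens βc j a s =
      ∫ s in Ioc 0 L.Cstar, P.real {ω | s ≤ C i j k ω} * ((trt a - ν s) * A s) * L.surv βc j a s *
        L.hazard βc j a s := by
    refine setIntegral_congr_fun measurableSet_Ioc fun s hs => ?_
    simp only [StudyLaw.dens]; ring
  have f2 : ∫ s in Ioc 0 L.Cstar, P.real {ω | s ≤ C i j k ω} * L.surv βc j a s *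
        (2 * (∫ v in Ioc 0 s, φ v) * φ s) =
      2 * ∫ s in Ioc 0 L.Cstar, P.real {ω | s ≤ C i j k ω} * ((trt a - ν s) * A s) *
        L.surv βc j a s * L.hazard β₀ j a s := by
    rw [← integral_const_mul]
    refine setIntegral_congr_fun measurableSet_Ioc fun s hs => ?_
    have hφs : φ s = (trt a - ν s) * L.hazard β₀ j a s := by
      simp only [hφdef, StudyLaw.scoreRate, e2 s hs]
    simp only [hAe s hs, hφs]
    ring
  have f3 : L.drift βc β₀ j a =
      -2 * ((∫ s in Ioc 0 L.Cstar, P.real {ω | s ≤ C i j k ω} * ((trt a - ν s) * A s) *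
          L.surv βc j a s * L.hazard βc j a s) -
        ∫ s in Ioc 0 L.Cstar, P.real {ω | s ≤ C i j k ω} * ((trt a - ν s) * A s) *
          L.surv βc j a s * L.hazard β₀ j a s) := by
    rw [← integral_sub i1 i2, StudyLaw.drift]
    congr 1
    refine setIntegral_congr_fun measurableSet_Ioc fun s hs => ?_
    have hAs : ∫ u in Ioc 0 s, (trt a - L.mu βc β₀ j u) * L.hazard β₀ j a u = A s := hAe s hs
    simp only [hAs, e2 s hs, StudyLaw.dens, ← h.law_C i j k s hs]
    ring
  rw [f0, f1, f2, f3]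
  ring

/-- The mixed moment given treatment: the four products of a jump or compensator of one score with
a jump or compensator of the other give the four components. -/
theorem setIntegral_indivScore_mul (h : IsTrialData L βc P Z T C) (hJ : 2 ≤ J) (β₀ : ℝ) (i : Fin n)
    {j l : Fin J} {k d : Fin m} (hne : (j, k) ≠ (l, d)) (a b : Bool) :
    ∫ ω in {ω | Z i j ω = a ∧ Z i l ω = b},
        indivScore L P Z T C β₀ i j k ω * indivScore L P Z T C β₀ i l d ω ∂P =
      L.prob₂ j l a b *
        (L.q1 βc β₀ j l a b + L.q2 βc β₀ j l a b + L.q3 βc β₀ j l a b + L.q4 βc β₀ j l a b) := by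
  by_cases hab : L.prob₂ j l a b = 0
  · have h0 : P {ω | Z i j ω = a ∧ Z i l ω = b} = 0 := by
      rw [← measureReal_eq_zero_iff, h.measureReal_treatment₂, hab]
    rw [setIntegral_measure_zero _ h0, hab, zero_mul]
  have hp := h.isCensoredPair hne i hab
  obtain ⟨ν, hν, hν01, hμ⟩ := h.exists_measurable_mu i k β₀ j
  obtain ⟨ν', hν', hν01', hμ'⟩ := h.exists_measurable_mu i d β₀ l
  have hφ := L.integrableOn_scoreRate hν hν01 hμ a
  have hψ := L.integrableOn_scoreRate hν' hν01' hμ' b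
  have hα : Measurable fun t => trt a - ν t := measurable_const.sub hν
  have hαM : ∀ t, |trt a - ν t| ≤ 1 := fun t => abs_trt_sub_le a (hν01 t)
  have hβ : Measurable fun t => trt b - ν' t := measurable_const.sub hν'
  have hβM : ∀ t, |trt b - ν' t| ≤ 1 := fun t => abs_trt_sub_le b (hν01' t)
  have e1 : ∫ ω in {ω | Z i j ω = a ∧ Z i l ω = b},
        indivScore L P Z T C β₀ i j k ω * indivScore L P Z T C β₀ i l d ω ∂P =
      ∫ ω in {ω | Z i j ω = a ∧ Z i l ω = b},
        (jumpPart L.Cstar (fun t => trt a - ν t) (T i j k ω) (C i j k ω) *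
            jumpPart L.Cstar (fun t => trt b - ν' t) (T i l d ω) (C i l d ω) -
          compPart L.Cstar (L.scoreRate βc β₀ j a) (T i j k ω) (C i j k ω) *
            jumpPart L.Cstar (fun t => trt b - ν' t) (T i l d ω) (C i l d ω) -
          jumpPart L.Cstar (fun t => trt a - ν t) (T i j k ω) (C i j k ω) *
            compPart L.Cstar (L.scoreRate βc β₀ l b) (T i l d ω) (C i l d ω) +
          compPart L.Cstar (L.scoreRate βc β₀ j a) (T i j k ω) (C i j k ω) *
            compPart L.Cstar (L.scoreRate βc β₀ l b) (T i l d ω) (C i l d ω)) ∂P := by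
    refine setIntegral_congr_fun (h.measurableSet_treatment₂ i j l a b) fun ω hω => ?_
    simp only [h.indivScore_eq hJ hμ, h.indivScore_eq hJ hμ', hω.1, hω.2]
    ring
  have hj := h.integrable_jumpPart i j k (c := L.Cstar) hα hαM
  have hj' := h.integrable_jumpPart i l d (c := L.Cstar) hβ hβM
  have hc := h.integrable_compPart i j k hφ
  have hc' := h.integrable_compPart i l d hψ
  have bj' : ∀ᵐ ω ∂P, ‖jumpPart L.Cstar (fun t => trt b - ν' t) (T i l d ω) (C i l d ω)‖ ≤ 1 :=
    ae_of_all _ fun _ => abs_jumpPart_le (fun t _ => hβM t) zero_le_one _ _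
  have bc' : ∀ᵐ ω ∂P, ‖compPart L.Cstar (L.scoreRate βc β₀ l b) (T i l d ω) (C i l d ω)‖ ≤
      ∫ u in Ioc 0 L.Cstar, |L.scoreRate βc β₀ l b u| := ae_of_all _ fun _ => abs_compPart_le hψ _ _
  have m1 := hj.mul_bdd hj'.aestronglyMeasurable bj'
  have m2 := hc.mul_bdd hj'.aestronglyMeasurable bj'
  have m3 := hj.mul_bdd hc'.aestronglyMeasurable bc'
  have m4 := hc.mul_bdd hc'.aestronglyMeasurable bc'
  rw [e1, setIntegral_sub_sub_add m1 m2 m3 m4,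
    hp.integral_jump_mul_jump hα hβ hαM hβM, hp.integral_comp_mul_jump hφ hβ hβM,
    hp.integral_jump_mul_comp hα hαM hψ, hp.integral_comp_mul_comp hφ hψ]
  have hs : MeasurableSet (Ioc 0 L.Cstar ×ˢ Ioc 0 L.Cstar) :=
    measurableSet_Ioc.prod measurableSet_Ioc
  have hG : ∀ x ∈ Ioc 0 L.Cstar ×ˢ Ioc 0 L.Cstar,
      jointSurvival P (C i j k) (C i l d) x.1 x.2 = L.censSurv₂ j l x.1 x.2 := fun x hx =>
    h.law_C₂ i j k l d hne _ hx.1 _ hx.2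
  have f1 : ∫ x in Ioc 0 L.Cstar ×ˢ Ioc 0 L.Cstar, jointSurvival P (C i j k) (C i l d) x.1 x.2 *
      (trt a - ν x.1) * (trt b - ν' x.2) * L.pairDens j l a b x.1 x.2 = L.q1 βc β₀ j l a b := by
    rw [StudyLaw.q1]
    refine setIntegral_congr_fun hs fun x hx => ?_
    simp only [hG x hx, StudyLaw.weight, hμ hx.1, hμ' hx.2]
  have f2 : ∫ x in Ioc 0 L.Cstar ×ˢ Ioc 0 L.Cstar, jointSurvival P (C i j k) (C i l d) x.1 x.2 *
      L.scoreRate βc β₀ j a x.1 * (trt b - ν' x.2) *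
      (∫ s in Ici x.1, L.pairDens j l a b s x.2) = -L.q2 βc β₀ j l a b := by
    rw [StudyLaw.q2, neg_neg]
    refine setIntegral_congr_ae hs ?_
    filter_upwards [ae_deriv_bivariateSurvival hp.measurable_dens hp.integrable_dens] with x hd hx
    simp only [hG x hx, StudyLaw.weight, hμ' hx.2, StudyLaw.scoreRate, StudyLaw.pairSurv, hd]
    ring
  have f3 : ∫ x in Ioc 0 L.Cstar ×ˢ Ioc 0 L.Cstar, jointSurvival P (C i j k) (C i l d) x.1 x.2 *
      (trt a - ν x.1) * L.scoreRate βc β₀ l b x.2 *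
      (∫ t in Ici x.2, L.pairDens j l a b x.1 t) = -L.q3 βc β₀ j l a b := by
    rw [StudyLaw.q3, neg_neg]
    refine setIntegral_congr_ae hs ?_
    filter_upwards [ae_deriv_bivariateSurvival_left hp.measurable_dens hp.integrable_dens]
      with x hd hx
    simp only [hG x hx, StudyLaw.weight, hμ hx.1, StudyLaw.scoreRate, StudyLaw.pairSurv, hd]
    ring
  have f4 : ∫ x in Ioc 0 L.Cstar ×ˢ Ioc 0 L.Cstar, jointSurvival P (C i j k) (C i l d) x.1 x.2 *
      L.scoreRate βc β₀ j a x.1 * L.scoreRate βc β₀ l b x.2 *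
      (∫ y in Ici x.1 ×ˢ Ici x.2, L.pairDens j l a b y.1 y.2) = L.q4 βc β₀ j l a b := by
    rw [StudyLaw.q4]
    refine setIntegral_congr_fun hs fun x hx => ?_
    simp only [hG x hx, StudyLaw.weight, StudyLaw.scoreRate, StudyLaw.pairSurv]
    ring
  rw [f1, f2, f3, f4]
  ring

theorem integral_indivScore (h : IsTrialData L βc P Z T C) (hJ : 2 ≤ J) (β₀ : ℝ) (i : Fin n)
    (j : Fin J) (k : Fin m) : P[indivScore L P Z T C β₀ i j k] = L.scoreMean βc β₀ j := by
  rw [integral_eq_sum_setIntegral_fiber (h.measurable_Z i j)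
    ((h.memLp_indivScore hJ β₀ i j k).integrable one_le_two), StudyLaw.scoreMean]
  exact Finset.sum_congr rfl fun a _ => h.setIntegral_indivScore hJ β₀ i j k a

theorem variance_indivScore (h : IsTrialData L βc P Z T C) (hJ : 2 ≤ J) (β₀ : ℝ) (i : Fin n)
    (j : Fin J) (k : Fin m) :
    variance (indivScore L P Z T C β₀ i j k) P = L.Upsilon0 βc β₀ j := by
  have hL := h.memLp_indivScore hJ β₀ i j k
  rw [variance_eq_sub hL, h.integral_indivScore hJ, StudyLaw.Upsilon0]
  congr 1
  have := integral_eq_sum_setIntegral_fiber (h.measurable_Z i j) hL.integrable_sq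
  simp_rw [h.setIntegral_indivScore_sq hJ] at this
  exact this

theorem covariance_indivScore (h : IsTrialData L βc P Z T C) (hJ : 2 ≤ J) (β₀ : ℝ) (i : Fin n)
    {j l : Fin J} {k d : Fin m} (hne : (j, k) ≠ (l, d)) :
    covariance (indivScore L P Z T C β₀ i j k) (indivScore L P Z T C β₀ i l d) P =
      L.Upsilon1 βc β₀ j l := by
  have hL := h.memLp_indivScore hJ β₀ i j k
  have hL' := h.memLp_indivScore hJ β₀ i l d
  rw [covariance_eq_sub hL hL', h.integral_indivScore hJ, h.integral_indivScore hJ,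
    StudyLaw.Upsilon1]
  congr 1
  have := integral_eq_sum_setIntegral_fiber ((h.measurable_Z i j).prodMk (h.measurable_Z i l))
    (hL.integrable_mul hL')
  rw [Fintype.sum_prod_type] at this
  simp only [Prod.mk.injEq, Pi.mul_apply, h.setIntegral_indivScore_mul hJ β₀ i hne] at this
  exact this

end IsTrialData

/-! ### The total score -/

theorem StudyLaw.condMean_self {J : ℕ} (L : StudyLaw J) (β : ℝ) (j : Fin J) (a : Bool) :
    L.condMean β β j a = 0 := by
  have h : ∀ s, L.dens β j a s - L.surv β j a s * L.hazard β j a s = 0 := fun s => by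
    rw [StudyLaw.dens]; ring
  simp [StudyLaw.condMean, h]

theorem StudyLaw.scoreMean_self {J : ℕ} (L : StudyLaw J) (β : ℝ) (j : Fin J) :
    L.scoreMean β β j = 0 := by
  simp [StudyLaw.scoreMean, L.condMean_self]

theorem StudyLaw.drift_self {J : ℕ} (L : StudyLaw J) (β : ℝ) (j : Fin J) (a : Bool) :
    L.drift β β j a = 0 := by
  have h : ∀ s, L.dens β j a s - L.surv β j a s * L.hazard β j a s = 0 := fun s => by
    rw [StudyLaw.dens]; ring
  simp [StudyLaw.drift, h]

namespace IsTrialData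

variable {Ω : Type*} [MeasurableSpace Ω] {P : Measure Ω} [IsProbabilityMeasure P]
  {J n m : ℕ} {L : StudyLaw J} {βc : ℝ} {Z : Fin n → Fin J → Ω → Bool}
  {T C : Fin n → Fin J → Fin m → Ω → ℝ}

/-- For `m = 1` no two distinct individuals share a cluster-period, and `Upsilon1 j j` is no
covariance; its coefficient `m (m - 1)` is then `0`. -/
theorem variance_clusterScore (h : IsTrialData L βc P Z T C) (hJ : 2 ≤ J) (β₀ : ℝ) (i : Fin n) :
    variance (fun ω => ∑ j, ∑ k, indivScore L P Z T C β₀ i j k ω) P =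
      m * ∑ j, L.Upsilon0 βc β₀ j + m * (m - 1) * ∑ j, L.Upsilon1 βc β₀ j j +
        m ^ 2 * ∑ j, ∑ l, if j ≠ l then L.Upsilon1 βc β₀ j l else 0 := by
  have e : (fun ω => ∑ j, ∑ k, indivScore L P Z T C β₀ i j k ω) =
      ∑ x : Fin J × Fin m, indivScore L P Z T C β₀ i x.1 x.2 := by
    funext ω
    rw [Finset.sum_apply, Fintype.sum_prod_type]
  have hpair : ∀ j l : Fin J, ∑ k : Fin m, ∑ d : Fin m,
      covariance (indivScore L P Z T C β₀ i j k) (indivScore L P Z T C β₀ i l d) P =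
      (if j = l then m * L.Upsilon0 βc β₀ j + m * (m - 1) * L.Upsilon1 βc β₀ j j else 0) +
        m ^ 2 * (if j ≠ l then L.Upsilon1 βc β₀ j l else 0) := by
    intro j l
    by_cases hjl : j = l
    · subst hjl
      have hc : ∀ k d : Fin m,
          covariance (indivScore L P Z T C β₀ i j k) (indivScore L P Z T C β₀ i j d) P =
          L.Upsilon1 βc β₀ j j +
            if k = d then L.Upsilon0 βc β₀ j - L.Upsilon1 βc β₀ j j else 0 := by
        intro k d
        by_cases hkd : k = d
        · subst hkd
          rw [covariance_self (h.memLp_indivScore hJ β₀ i j k).aemeasurable,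
            h.variance_indivScore hJ, if_pos rfl]
          ring
        · rw [h.covariance_indivScore hJ β₀ i (by simpa using hkd), if_neg hkd, add_zero]
      simp_rw [hc, Finset.sum_add_distrib]
      simp
      ring
    · have hc : ∀ k d : Fin m,
          covariance (indivScore L P Z T C β₀ i j k) (indivScore L P Z T C β₀ i l d) P =
          L.Upsilon1 βc β₀ j l := fun k d => by
        have hne : (j, k) ≠ (l, d) := fun he => hjl (congrArg Prod.fst he)
        exact h.covariance_indivScore hJ β₀ i hne
      simp_rw [hc]
      simp [hjl]
      ring
  rw [e, variance_sum (X := fun x : Fin J × Fin m => indivScore L P Z T C β₀ i x.1 x.2)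
    fun x => h.memLp_indivScore hJ β₀ i x.1 x.2]
  simp only [Fintype.sum_prod_type]
  have hcomm : ∀ j : Fin J, ∑ k : Fin m, ∑ l : Fin J, ∑ d : Fin m,
      covariance (indivScore L P Z T C β₀ i j k) (indivScore L P Z T C β₀ i l d) P =
      ∑ l : Fin J, ∑ k : Fin m, ∑ d : Fin m,
      covariance (indivScore L P Z T C β₀ i j k) (indivScore L P Z T C β₀ i l d) P :=
    fun j => Finset.sum_comm
  simp_rw [hcomm, hpair, Finset.sum_add_distrib]
  simp only [Finset.sum_ite_eq, Finset.mem_univ, if_true, Finset.sum_add_distrib,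
    ← Finset.mul_sum]

theorem variance_totalScore (h : IsTrialData L βc P Z T C) (hJ : 2 ≤ J) (hn : 1 ≤ n) (hm : 1 ≤ m)
    (β₀ : ℝ) :
    variance (totalScore L P Z T C β₀) P =
      n * (m * ∑ j, L.Upsilon0 βc β₀ j + m * (m - 1) * ∑ j, L.Upsilon1 βc β₀ j j +
        m ^ 2 * ∑ j, ∑ l, if j ≠ l then L.Upsilon1 βc β₀ j l else 0) := by
  choose g hg _ he using fun j => h.exists_measurable_score hJ ⟨0, hn⟩ ⟨0, hm⟩ β₀ j
  have e : totalScore L P Z T C β₀ =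
      ∑ i, fun ω => ∑ j, ∑ k, indivScore L P Z T C β₀ i j k ω := by
    funext ω
    simp [totalScore, Finset.sum_apply]
  have hind : iIndepFun (fun i ω => ∑ j, ∑ k, indivScore L P Z T C β₀ i j k ω) P := by
    have hG : Measurable fun x : (Fin J → Bool) × (Fin J → Fin m → ℝ) × (Fin J → Fin m → ℝ) =>
        ∑ j, ∑ k, g j (x.1 j, x.2.1 j k, x.2.2 j k) :=
      Finset.measurable_fun_sum _ fun j _ => Finset.measurable_fun_sum _ fun k _ =>
        (hg j).comp (by fun_prop)
    have := h.indep_clusters.comp (fun _ => _) fun _ => hG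
    simp_rw [he]
    exact this
  rw [e, IndepFun.variance_sum (fun i _ => memLp_finsetSum _ fun j _ =>
    memLp_finsetSum _ fun k _ => h.memLp_indivScore hJ β₀ i j k)
    fun i _ i' _ hii' => hind.indepFun hii']
  simp_rw [h.variance_clusterScore hJ]
  rw [Finset.sum_const, Finset.card_univ, Fintype.card_fin, nsmul_eq_mul]

/-- If the marginal variances sum to zero, they all vanish, so that every individual score is
almost surely constant. -/
theorem variance_totalScore_eq_zero (h : IsTrialData L βc P Z T C) (hJ : 2 ≤ J) (hn : 1 ≤ n)
    (hm : 1 ≤ m) (β₀ : ℝ) (h0 : ∑ j, L.Upsilon0 βc β₀ j = 0) :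
    variance (totalScore L P Z T C β₀) P = 0 := by
  have hnn : ∀ j ∈ Finset.univ, 0 ≤ L.Upsilon0 βc β₀ j := fun j _ => by
    rw [← h.variance_indivScore hJ β₀ ⟨0, hn⟩ j ⟨0, hm⟩]
    exact variance_nonneg _ _
  have hz := (Finset.sum_eq_zero_iff_of_nonneg hnn).1 h0
  have hconst : ∀ᵐ ω ∂P, ∀ i j k, indivScore L P Z T C β₀ i j k ω =
      P[indivScore L P Z T C β₀ i j k] := by
    simp only [ae_all_iff]
    intro i j k
    refine ae_eq_integral_of_variance_eq_zero (h.memLp_indivScore hJ β₀ i j k) ?_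
    rw [h.variance_indivScore hJ, hz j (Finset.mem_univ j)]
  have he : totalScore L P Z T C β₀ =ᵐ[P]
      fun _ => ∑ i, ∑ j, ∑ k, P[indivScore L P Z T C β₀ i j k] := by
    filter_upwards [hconst] with ω hω
    simp only [totalScore, hω]
  rw [variance_congr he]
  simp [variance_eq_integral aemeasurable_const]

end IsTrialData

end

theorem proposition1p1 {Ω : Type*} [MeasurableSpace Ω] (P : Measure Ω) [IsProbabilityMeasure P]
    {J n m : ℕ} (hJ : 2 ≤ J) (hn : 1 ≤ n) (hm : 1 ≤ m)
    (β₀ β₁ : ℝ) (c : Fin 2) (βc : ℝ) (hβc : βc = ![β₀, β₁] c) (L : StudyLaw J)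
    (Z : Fin n → Fin J → Ω → Bool) (T C : Fin n → Fin J → Fin m → Ω → ℝ)
    (hdata : IsTrialData L βc P Z T C) :
    (∀ i j k, MemLp (indivScore L P Z T C β₀ i j k) 2 P) ∧
    (∀ i j k, variance (indivScore L P Z T C β₀ i j k) P = L.Upsilon0 βc β₀ j) ∧
    (∀ i j k l d, (j, k) ≠ (l, d) →
      covariance (indivScore L P Z T C β₀ i j k) (indivScore L P Z T C β₀ i l d) P =
        L.Upsilon1 βc β₀ j l) ∧
    variance (totalScore L P Z T C β₀) P =
      ((n : ℝ) * m * ∑ j, L.Upsilon0 βc β₀ j) *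
        (1 + ((m : ℝ) - 1) * L.kappaW βc β₀ + m * ((J : ℝ) - 1) * L.kappaB βc β₀) ∧
    variance (fun ω => totalScore L P Z T C β₀ ω / ((n : ℝ) * m)) P =
      (1 / ((n : ℝ) * m) * ∑ j, L.Upsilon0 βc β₀ j) *
        (1 + ((m : ℝ) - 1) * L.kappaW βc β₀ + m * ((J : ℝ) - 1) * L.kappaB βc β₀) ∧
    (c = 0 →
      (∀ j, L.Upsilon0 βc β₀ j = ∑ a : Bool, L.prob j a * L.q0 βc β₀ j a) ∧
      (∀ j l, L.Upsilon1 βc β₀ j l = ∑ a : Bool, ∑ b : Bool, L.prob₂ j l a b *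
        (L.q1 βc β₀ j l a b + L.q2 βc β₀ j l a b + L.q3 βc β₀ j l a b +
          L.q4 βc β₀ j l a b))) := by
  have hvar : variance (totalScore L P Z T C β₀) P =
      ((n : ℝ) * m * ∑ j, L.Upsilon0 βc β₀ j) *
        (1 + ((m : ℝ) - 1) * L.kappaW βc β₀ + m * ((J : ℝ) - 1) * L.kappaB βc β₀) := by
    by_cases h0 : ∑ j, L.Upsilon0 βc β₀ j = 0
    · rw [hdata.variance_totalScore_eq_zero hJ hn hm β₀ h0, h0, mul_zero, zero_mul]
    · have hJ1 : (J : ℝ) - 1 ≠ 0 := by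
        have : (2 : ℝ) ≤ J := by exact_mod_cast hJ
        linarith
      rw [hdata.variance_totalScore hJ hn hm, StudyLaw.kappaW, StudyLaw.kappaB]
      field_simp
  refine ⟨hdata.memLp_indivScore hJ β₀, hdata.variance_indivScore hJ β₀,
    fun i j k l d hne => hdata.covariance_indivScore hJ β₀ i hne, hvar, ?_, fun hc => ?_⟩
  · have hn0 : (n : ℝ) ≠ 0 := Nat.cast_ne_zero.2 (by lia)
    have hm0 : (m : ℝ) ≠ 0 := Nat.cast_ne_zero.2 (by lia)
    simp_rw [div_eq_mul_inv]
    rw [variance_mul_const, hvar]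
    field_simp
  · have hβ : βc = β₀ := by simp [hβc, hc]
    subst hβ
    exact ⟨fun j => by simp [StudyLaw.Upsilon0, L.drift_self, L.scoreMean_self],
      fun j l => by simp [StudyLaw.Upsilon1, L.scoreMean_self]⟩
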